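/- Let $N\ge 5$ and let $d\mu=\mu(x)\,dx$ be a probability measure on $\mathbb R^N$ with density $0\le\mu\in L^1(\mathbb R^N)$. Put $C_0=\left(\frac{N-2}{2}\right)^2$, $U=\frac14\left|\frac{\nabla\mu}{\mu}\right|^2-\frac12\frac{\Delta\mu}{\mu}$ (weak derivatives), $L^2_\mu=L^2(\mathbb R^N,d\mu)$ (complex-valued functions), and, for smooth $u$, $Lu=\Delta u+\frac{\nabla\mu}{\mu}\cdot\nabla u$. Pointwise bounds on $\mu$ and $U$ are understood almost everywhere, and those on $U$ only where $\mu>0$. Consider the hypotheses (H1) $\mu\in H^1_{\rm loc}(\mathbb R^N)$, $\frac{\nabla\mu}{\mu}\in L^r_{\rm loc}(\mathbb R^N,\mathbb R^N)$ for some $r>N$, and $\inf_K\mu>0$ for every compact $K\subset\mathbb R^N$; (H2) $\sqrt\mu\in H^1_{\rm loc}(\mathbb R^N)$ and $\Delta\mu\in L^1_{\rm loc}(\mathbb R^N)$; there is $R_0>0$ such that $|x|^2U(x)\le\frac14\frac{1}{|\log|x||^2}$ for $|x|<R_0$; and $U$ is bounded from above on $\mathbb R^N\setminus B_R$ for every $R>0$.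 Assume (H2). Then there is a constant $C_1>0$ such that the weighted Hardy inequality $$C_0\int_{\mathbb R^N}\frac{|\varphi|^2}{|x|^2}\,d\mu\le\int_{\mathbb R^N}|\nabla\varphi|^2\,d\mu+C_1\int_{\mathbb R^N}|\varphi|^2\,d\mu\qquad(\varphi\in C_c^\infty(\mathbb R^N))$$ holds, where all the integrals are finite. For every such constant $C_1$ and every $u\in C_c^\infty(\mathbb R^N)$ one has $\frac{u}{|x|^2}\in L^2_\mu$, $Lu\in L^2_\mu$, and: (i) for every $\varepsilon>0$, $$\left((C_0-1)^2-\varepsilon\right)\int_{\mathbb R^N}\frac{|u|^2}{|x|^4}\,d\mu\le\int_{\mathbb R^N}|Lu|^2\,d\mu+\frac{((C_0-1)C_1)^2}{\varepsilon}\int_{\mathbb R^N}|u|^2\,d\mu;$$ (ii) $$(C_0-1)^2\int_{\mathbb R^N}\frac{|u|^2}{|x|^4}\,d\mu\le\int_{\mathbb R^N}|Lu|^2\,d\mu+\frac{2(C_0-1)C_1}{C_0}\int_{\mathbb R^N}|\nabla u|^2\,d\mu+\frac{2(C_0-1)C_1^2}{C_0}\int_{\mathbb R^N}|u|^2\,d\mu.$$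 If in addition (H1) holds and $(L,D(L))$ denotes the closure of $(L,C_c^\infty(\mathbb R^N))$ in $L^2_\mu$, then every $u\in D(L)$ has a weak gradient $\nabla u\in L^2_\mu$ and satisfies $\frac{u}{|x|^2}\in L^2_\mu$, and (i) and (ii) hold for all $u\in D(L)$ with the same constants. -/

import Mathlib

open MeasureTheory Filter Topology
open scoped ContDiff ENNReal

noncomputable section

namespace WeightedRellich

/-- `ℝ^N` with its Euclidean norm. -/
abbrev Sp (N : ℕ) := EuclideanSpace ℝ (Fin N)

/-- The `i`-th coordinate vector. -/
def stdVec {N : ℕ} (i : Fin N) : Sp N := EuclideanSpace.single i (1 : ℝ)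

/-- `φ ∈ C_c^∞(ℝ^N)`, with values in `F` (here `ℝ` or `ℂ`). -/
def IsTest {N : ℕ} {F : Type*} [NormedAddCommGroup F] [NormedSpace ℝ F] (φ : Sp N → F) : Prop :=
  ContDiff ℝ ∞ φ ∧ HasCompactSupport φ

/-- The classical partial derivative `∂_i u`. -/
def partialD {N : ℕ} {F : Type*} [NormedAddCommGroup F] [NormedSpace ℝ F]
    (i : Fin N) (u : Sp N → F) (x : Sp N) : F :=
  fderiv ℝ u x (stdVec i)

/-- `f ∈ L^p_loc(ℝ^N)` with respect to Lebesgue measure. -/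
def LocMemLp {N : ℕ} {F : Type*} [NormedAddCommGroup F] (f : Sp N → F) (p : ℝ≥0∞) : Prop :=
  ∀ K : Set (Sp N), IsCompact K → MemLp f p (volume.restrict K)

/-- `g ∈ L^1_loc` is the weak partial derivative `∂_i f` of `f ∈ L^1_loc`. -/
def HasWeakPartial {N : ℕ} {F : Type*} [NormedAddCommGroup F] [NormedSpace ℝ F]
    (i : Fin N) (f g : Sp N → F) : Prop :=
  LocallyIntegrable f ∧ LocallyIntegrable g ∧
    ∀ φ : Sp N → ℝ, IsTest φ → ∫ x, partialD i φ x • f x = - ∫ x, φ x • g x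

/-- `g ∈ L^1_loc` is the distributional Laplacian of `f ∈ L^1_loc`. -/
def HasWeakLaplacian {N : ℕ} (f g : Sp N → ℝ) : Prop :=
  LocallyIntegrable f ∧ LocallyIntegrable g ∧
    ∀ φ : Sp N → ℝ, IsTest φ → ∫ x, Laplacian.laplacian φ x * f x = ∫ x, φ x * g x

open Classical in
/-- The weak partial derivative of `f` (unique up to null sets); zero if there is none. -/
def weakPartial {N : ℕ} (i : Fin N) (f : Sp N → ℝ) : Sp N → ℝ :=
  if h : ∃ g, HasWeakPartial i f g then h.choose else 0

open Classical in
/-- The distributional Laplacian of `f` as a locally integrable function (unique up to null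
sets); zero if there is none. -/
def weakLaplacian {N : ℕ} (f : Sp N → ℝ) : Sp N → ℝ :=
  if h : ∃ g, HasWeakLaplacian f g then h.choose else 0

/-- `f ∈ H^1_loc(ℝ^N)`. -/
def MemH1loc {N : ℕ} (f : Sp N → ℝ) : Prop :=
  LocMemLp f 2 ∧ ∀ i : Fin N, ∃ g, HasWeakPartial i f g ∧ LocMemLp g 2

/-- `μ` is (a version of) a probability density with respect to Lebesgue measure. -/
structure IsProbDensity {N : ℕ} (μ : Sp N → ℝ) : Prop where
  nonneg : ∀ᵐ x : Sp N, 0 ≤ μ x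
  integrable : Integrable μ
  integral_eq_one : ∫ x, μ x = 1

/-- The measure `dμ = μ(x) dx`. -/
def wMeasure {N : ℕ} (μ : Sp N → ℝ) : Measure (Sp N) :=
  volume.withDensity fun x => ENNReal.ofReal (μ x)

/-- The `i`-th component of the drift `∇μ / μ`. -/
def drift {N : ℕ} (μ : Sp N → ℝ) (i : Fin N) (x : Sp N) : ℝ :=
  weakPartial i μ x / μ x

/-- `U = (1/4) |∇μ/μ|² - (1/2) Δμ/μ`. -/
def potU {N : ℕ} (μ : Sp N → ℝ) (x : Sp N) : ℝ :=
  (1 / 4) * ∑ i : Fin N, drift μ i x ^ 2 - (1 / 2) * (weakLaplacian μ x / μ x)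

/-- Hypothesis (H1): `μ ∈ H^1_loc`, `∇μ/μ ∈ L^r_loc` for some `r > N`, and `inf_K μ > 0` for
every compact set `K`. -/
structure HypH1 {N : ℕ} (μ : Sp N → ℝ) : Prop where
  memH1loc : MemH1loc μ
  drift_mem : ∃ r : ℝ, (N : ℝ) < r ∧ ∀ i : Fin N, LocMemLp (drift μ i) (ENNReal.ofReal r)
  pos : ∀ K : Set (Sp N), IsCompact K → ∃ c : ℝ, 0 < c ∧ ∀ᵐ x : Sp N, x ∈ K → c ≤ μ x

/-- Hypothesis (H2). As `μ`, `∇μ` and `Δμ` are defined almost everywhere, so are the pointwise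
bounds; they are only required where `μ > 0`, where the quotients in `U` make sense. -/
structure HypH2 {N : ℕ} (μ : Sp N → ℝ) : Prop where
  sqrt_memH1loc : MemH1loc fun x => Real.sqrt (μ x)
  laplacian_mem : ∃ g, HasWeakLaplacian μ g
  near_zero : ∃ R₀ : ℝ, 0 < R₀ ∧ ∀ᵐ x : Sp N, 0 < μ x → ‖x‖ < R₀ →
    ‖x‖ ^ 2 * potU μ x ≤ (1 / 4) * (1 / |Real.log ‖x‖| ^ 2)
  away_zero : ∀ R : ℝ, 0 < R → ∃ M : ℝ, ∀ᵐ x : Sp N, 0 < μ x → R ≤ ‖x‖ → potU μ x ≤ M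

/-- The Kolmogorov operator `L u = Δu + (∇μ/μ) · ∇u` on smooth functions. -/
def kolmogorov {N : ℕ} (μ : Sp N → ℝ) (u : Sp N → ℂ) (x : Sp N) : ℂ :=
  Laplacian.laplacian u x + ∑ i : Fin N, drift μ i x • partialD i u x

/-- `f ∈ D(L)` and `L f = g`, where `(L, D(L))` is the closure of `(L, C_c^∞(ℝ^N))` on
`L²(ℝ^N, dμ)`: the pair `(f, g)` is a limit in `L² × L²` of pairs `(u_n, L u_n)` with
`u_n ∈ C_c^∞(ℝ^N)`. -/
def ClosureL {N : ℕ} (μ : Sp N → ℝ) (f g : Sp N → ℂ) : Prop :=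
  MemLp f 2 (wMeasure μ) ∧ MemLp g 2 (wMeasure μ) ∧
    ∃ u : ℕ → Sp N → ℂ, (∀ n, IsTest (u n)) ∧
      Tendsto (fun n => eLpNorm (fun x => u n x - f x) 2 (wMeasure μ)) atTop (𝓝 0) ∧
      Tendsto (fun n => eLpNorm (fun x => kolmogorov μ (u n) x - g x) 2 (wMeasure μ)) atTop (𝓝 0)

/-- The Hardy constant `C₀ = ((N - 2) / 2)²`. -/
def hardyC (N : ℕ) : ℝ := (((N : ℝ) - 2) / 2) ^ 2

/-- The weighted Hardy inequality
`C₀ ∫ |φ|²/|x|² dμ ≤ ∫ |∇φ|² dμ + C₁ ∫ |φ|² dμ` with constant `C₁`, for `φ ∈ C_c^∞(ℝ^N)`. -/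
def WeightedHardy {N : ℕ} (μ : Sp N → ℝ) (C₁ : ℝ) : Prop :=
  ∀ φ : Sp N → ℂ, IsTest φ →
    Integrable (fun x => ‖φ x‖ ^ 2 / ‖x‖ ^ 2) (wMeasure μ) ∧
    hardyC N * ∫ x, ‖φ x‖ ^ 2 / ‖x‖ ^ 2 ∂(wMeasure μ) ≤
      ∫ x, ∑ i : Fin N, ‖partialD i φ x‖ ^ 2 ∂(wMeasure μ) +
        C₁ * ∫ x, ‖φ x‖ ^ 2 ∂(wMeasure μ)

/-- The `ε`-version of the weighted Rellich inequality for a function `u` with `L u = v`. -/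
def RellichEps {N : ℕ} (μ : Sp N → ℝ) (C₁ : ℝ) (u v : Sp N → ℂ) : Prop :=
  ∀ ε : ℝ, 0 < ε →
    ((hardyC N - 1) ^ 2 - ε) * ∫ x, ‖u x‖ ^ 2 / ‖x‖ ^ 4 ∂(wMeasure μ) ≤
      ∫ x, ‖v x‖ ^ 2 ∂(wMeasure μ) +
        ((hardyC N - 1) * C₁) ^ 2 / ε * ∫ x, ‖u x‖ ^ 2 ∂(wMeasure μ)

/-- The weighted Rellich inequality with sharp constant for a function `u` with `L u = v` and
gradient `G = (G_1, …, G_N)`. -/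
def RellichSharp {N : ℕ} (μ : Sp N → ℝ) (C₁ : ℝ) (u v : Sp N → ℂ)
    (G : Fin N → Sp N → ℂ) : Prop :=
  (hardyC N - 1) ^ 2 * ∫ x, ‖u x‖ ^ 2 / ‖x‖ ^ 4 ∂(wMeasure μ) ≤
    ∫ x, ‖v x‖ ^ 2 ∂(wMeasure μ) +
      2 * (hardyC N - 1) * C₁ / hardyC N * ∫ x, ∑ i : Fin N, ‖G i x‖ ^ 2 ∂(wMeasure μ) +
      2 * (hardyC N - 1) * C₁ ^ 2 / hardyC N * ∫ x, ‖u x‖ ^ 2 ∂(wMeasure μ)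

end WeightedRellich

end

/-! The Hardy inequality comes from completing a square. For a smooth vector field `F` and `q =
|φ|²`, expanding `0 ≤ ∫ |∇φ + (F + ∇μ/(2μ)) φ|² dμ` and integrating by parts gives `∫ (div F - |F|²)
q dμ ≤ ∫ |∇φ|² dμ + ∫ q (|∇μ|²/(4μ) - Δμ/2) dx` (`integral_vectorField_le`). The last integrand is
`U q μ` where `μ > 0`. On `{μ = 0}` it is `-q Δμ/2`, which is harmless because a nonnegative
function has nonnegative Laplacian at almost every zero (`weakLaplacian_nonneg_of_eq_zero`). The
field is `F = ((N-2)/2 + a(|x|²)) x/|x|²` with `a(t) = 1/log(e + 1/t)`. Its potential exceeds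
`C₀/|x|²` near the origin by `1/(4 |x|² log²|x|)` up to a bounded error, which is exactly the growth
allowed to `U`. Replacing `|x|²` by `|x|² + δ` makes `F` smooth, and Fatou's lemma lets `δ → 0`.

For Rellich, put `r = (|x|² + δ)^(-1/2)` and pair `Lu` with `r² u`. By parts, `-∫ ⟨r² u, Lu⟩ dμ = ∫
|∇(r u)|² dμ - ∫ |∇r|² |u|² dμ` with `|∇r|² ≤ r⁴`. Hardy applied to `r u` then yields `(C₀ - 1) A ≤
√A ‖Lu‖ + C₁ B`, where `A = ∫ r⁴ |u|² dμ` and `B = ∫ r² |u|² dμ` (`rellich_regularised`). Bounding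
`B` by `√A ‖u‖` leads to (i), bounding it by Hardy for `u` leads to (ii), and again `δ → 0` by
Fatou.

On the closure, `∫ |∇u|² dμ ≤ ‖u‖ ‖Lu‖` makes the gradients of the approximants Cauchy. Since `μ` is
bounded below on compact sets, their limit is a weak gradient, and both inequalities pass to the
limit. -/

noncomputable section

namespace WeightedRellich

/-! ### Calculus of test functions and radial functions -/

section Test

variable {N : ℕ} {F : Type*} [NormedAddCommGroup F] [NormedSpace ℝ F]

theorem IsTest.continuous {φ : Sp N → F} (h : IsTest φ) : Continuous φ := h.1.continuous

theorem IsTest.differentiable {φ : Sp N → F} (h : IsTest φ) : Differentiable ℝ φ :=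
  h.1.differentiable (by simp)

theorem contDiff_partialD {φ : Sp N → F} (h : ContDiff ℝ ∞ φ) (i : Fin N) :
    ContDiff ℝ ∞ (partialD i φ) :=
  (h.fderiv_right (m := ∞) (by simp)).clm_apply contDiff_const

theorem IsTest.partialD {φ : Sp N → F} (h : IsTest φ) (i : Fin N) : IsTest (partialD i φ) :=
  ⟨contDiff_partialD h.1 i, h.2.fderiv_apply ℝ _⟩

theorem IsTest.sub {φ ψ : Sp N → F} (h : IsTest φ) (h' : IsTest ψ) :
    IsTest (fun x => φ x - ψ x) :=
  ⟨h.1.sub h'.1, h.2.sub h'.2⟩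

theorem IsTest.smul_left {b : Sp N → ℝ} {φ : Sp N → F} (hb : ContDiff ℝ ∞ b) (h : IsTest φ) :
    IsTest (fun x => b x • φ x) :=
  ⟨hb.smul h.1, h.2.smul_left⟩

theorem IsTest.mul_left {b φ : Sp N → ℝ} (hb : ContDiff ℝ ∞ b) (h : IsTest φ) :
    IsTest (fun x => b x * φ x) :=
  h.smul_left hb

theorem IsTest.mul_right {b φ : Sp N → ℝ} (h : IsTest φ) (hb : ContDiff ℝ ∞ b) :
    IsTest (fun x => φ x * b x) := by
  simpa only [mul_comm] using h.mul_left hb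

theorem IsTest.inner {E : Type*} [NormedAddCommGroup E] [InnerProductSpace ℝ E]
    {φ ψ : Sp N → E} (h : IsTest φ) (h' : ContDiff ℝ ∞ ψ) :
    IsTest (fun x => inner ℝ (φ x) (ψ x)) :=
  ⟨h.1.inner ℝ h', h.2.mono (by
    intro x hx
    contrapose! hx
    simp only [Function.mem_support, ne_eq, not_not] at hx ⊢
    simp [hx])⟩

theorem IsTest.norm_sq {E : Type*} [NormedAddCommGroup E] [InnerProductSpace ℝ E]
    {φ : Sp N → E} (h : IsTest φ) : IsTest (fun x => ‖φ x‖ ^ 2) := by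
  simpa only [real_inner_self_eq_norm_sq] using h.inner h.1

theorem partialD_mul {f g : Sp N → ℝ} (hf : Differentiable ℝ f) (hg : Differentiable ℝ g)
    (i : Fin N) (x : Sp N) :
    partialD i (fun y => f y * g y) x = partialD i f x * g x + f x * partialD i g x := by
  simp only [partialD]
  rw [fderiv_fun_mul (hf x) (hg x)]
  simp only [add_apply, smul_apply, smul_eq_mul]
  ring

theorem partialD_smul {f : Sp N → ℝ} {g : Sp N → F} (hf : Differentiable ℝ f)
    (hg : Differentiable ℝ g) (i : Fin N) (x : Sp N) :
    partialD i (fun y => f y • g y) x = partialD i f x • g x + f x • partialD i g x := by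
  simp only [partialD]
  rw [fderiv_fun_smul (hf x) (hg x)]
  simp only [add_apply, smul_apply,
    ContinuousLinearMap.smulRight_apply]
  abel

theorem partialD_sub {f g : Sp N → F} (hf : Differentiable ℝ f)
    (hg : Differentiable ℝ g) (i : Fin N) (x : Sp N) :
    partialD i (fun y => f y - g y) x = partialD i f x - partialD i g x := by
  simp only [partialD]
  rw [fderiv_fun_sub (hf x) (hg x)]
  rfl

theorem partialD_inner {E : Type*} [NormedAddCommGroup E] [InnerProductSpace ℝ E]
    {f g : Sp N → E} (hf : Differentiable ℝ f) (hg : Differentiable ℝ g)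
    (i : Fin N) (x : Sp N) :
    partialD i (fun y => inner ℝ (f y) (g y)) x =
      inner ℝ (f x) (partialD i g x) + inner ℝ (partialD i f x) (g x) :=
  fderiv_inner_apply ℝ (hf x) (hg x) _

theorem partialD_norm_sq {E : Type*} [NormedAddCommGroup E] [InnerProductSpace ℝ E]
    {f : Sp N → E} (hf : Differentiable ℝ f) (i : Fin N) (x : Sp N) :
    partialD i (fun y => ‖f y‖ ^ 2) x = 2 * inner ℝ (f x) (partialD i f x) := by
  simp only [← real_inner_self_eq_norm_sq]
  rw [partialD_inner hf hf, real_inner_comm]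
  ring

theorem laplacian_eq_sum {u : Sp N → F} (hu : ContDiff ℝ ∞ u) (x : Sp N) :
    Laplacian.laplacian u x = ∑ i, partialD i (partialD i u) x := by
  rw [InnerProductSpace.laplacian_eq_iteratedFDeriv_orthonormalBasis u
    (EuclideanSpace.basisFun (Fin N) ℝ)]
  refine Finset.sum_congr rfl fun i _ => ?_
  rw [iteratedFDeriv_two_apply]
  have h : DifferentiableAt ℝ (fderiv ℝ u) x :=
    (hu.fderiv_right (m := ∞) (by simp)).differentiable (by simp) x
  change _ = fderiv ℝ (fun y => fderiv ℝ u y (stdVec i)) x (stdVec i)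
  rw [fderiv_clm_apply h (differentiableAt_const _)]
  simp [stdVec]

theorem integral_partialD_smul {φ : Sp N → ℝ} {u : Sp N → F} (hφ : IsTest φ) (hu : ContDiff ℝ ∞ u)
    (i : Fin N) : ∫ x, partialD i φ x • u x = - ∫ x, φ x • partialD i u x := by
  have h1 : Integrable fun x => partialD i φ x • u x :=
    ((hφ.partialD i).continuous.smul hu.continuous).integrable_of_hasCompactSupport
      (hφ.partialD i).2.smul_right
  have h2 : Integrable fun x => φ x • partialD i u x :=
    (hφ.continuous.smul (contDiff_partialD hu i).continuous).integrable_of_hasCompactSupport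
      hφ.2.smul_right
  have h3 : Integrable fun x => φ x • u x :=
    (hφ.continuous.smul hu.continuous).integrable_of_hasCompactSupport hφ.2.smul_right
  exact (neg_eq_iff_eq_neg.2 (integral_smul_fderiv_eq_neg_fderiv_smul_of_integrable
    (v := stdVec i) h1 h2 h3 (fun x _ => hφ.differentiable x)
    (fun x _ => hu.differentiable (by simp) x))).symm

theorem contDiff_coord (i : Fin N) : ContDiff ℝ ∞ (fun x : Sp N => x i) :=
  (EuclideanSpace.proj i : Sp N →L[ℝ] ℝ).contDiff

theorem partialD_coord (i : Fin N) (x : Sp N) : partialD i (fun y : Sp N => y i) x = 1 := by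
  have : (fun y : Sp N => y i) = (EuclideanSpace.proj i : Sp N →L[ℝ] ℝ) := rfl
  rw [partialD, this, ContinuousLinearMap.fderiv]
  simp [stdVec]

theorem sum_coord_sq (x : Sp N) : ∑ i, x i ^ 2 = ‖x‖ ^ 2 := by
  simp [EuclideanSpace.norm_sq_eq]

theorem hasFDerivAt_radial {b : ℝ → ℝ} {b' : ℝ} {x : Sp N} (h : HasDerivAt b b' (‖x‖ ^ 2)) :
    HasFDerivAt (fun y : Sp N => b (‖y‖ ^ 2)) (b' • (2 • innerSL ℝ x)) x :=
  h.comp_hasFDerivAt x (hasStrictFDerivAt_norm_sq x).hasFDerivAt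

theorem partialD_radial {b : ℝ → ℝ} {b' : ℝ} {x : Sp N} (h : HasDerivAt b b' (‖x‖ ^ 2))
    (i : Fin N) : partialD i (fun y : Sp N => b (‖y‖ ^ 2)) x = 2 * b' * x i := by
  rw [partialD, (hasFDerivAt_radial h).fderiv]
  simp [stdVec, EuclideanSpace.inner_single_right, innerSL_apply_apply]
  ring

theorem sum_partialD_radial_mul_coord {b : ℝ → ℝ} {b' : ℝ} {x : Sp N}
    (hb : Differentiable ℝ (fun y : Sp N => b (‖y‖ ^ 2))) (h : HasDerivAt b b' (‖x‖ ^ 2)) :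
    ∑ i, partialD i (fun y : Sp N => b (‖y‖ ^ 2) * y i) x =
      N * b (‖x‖ ^ 2) + 2 * b' * ‖x‖ ^ 2 := by
  have : ∀ i : Fin N, partialD i (fun y : Sp N => b (‖y‖ ^ 2) * y i) x =
      2 * b' * x i ^ 2 + b (‖x‖ ^ 2) := fun i => by
    rw [partialD_mul hb ((contDiff_coord i).differentiable (by simp)), partialD_radial h,
      partialD_coord]
    ring
  simp only [this, Finset.sum_add_distrib, ← Finset.mul_sum, sum_coord_sq]
  simp
  ring

end Test

/-! ### The measure `μ dx` and a Fatou lemma -/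

section Measure

variable {N : ℕ} {μ : Sp N → ℝ}

theorem _root_.MeasureTheory.LocallyIntegrable.integrable_mul_test {f ψ : Sp N → ℝ}
    (hf : LocallyIntegrable f) (hψ : Continuous ψ) (hs : HasCompactSupport ψ) :
    Integrable fun x => ψ x * f x :=
  hf.integrable_smul_left_of_hasCompactSupport hψ hs

theorem integrable_wMeasure_iff (hμ : IsProbDensity μ) {F : Type*} [NormedAddCommGroup F]
    [NormedSpace ℝ F] {f : Sp N → F} :
    Integrable f (wMeasure μ) ↔ Integrable fun x => μ x • f x := by
  rw [wMeasure, integrable_withDensity_iff_integrable_smul₀'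
    hμ.integrable.aemeasurable.ennreal_ofReal (by simp)]
  refine integrable_congr ?_
  filter_upwards [hμ.nonneg] with x hx
  rw [ENNReal.toReal_ofReal hx]

theorem integral_wMeasure (hμ : IsProbDensity μ) {F : Type*} [NormedAddCommGroup F]
    [NormedSpace ℝ F] (f : Sp N → F) :
    ∫ x, f x ∂(wMeasure μ) = ∫ x, μ x • f x := by
  rw [wMeasure, integral_withDensity_eq_integral_toReal_smul₀
    hμ.integrable.aemeasurable.ennreal_ofReal (by simp)]
  refine integral_congr_ae ?_
  filter_upwards [hμ.nonneg] with x hx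
  rw [ENNReal.toReal_ofReal hx]

theorem wMeasure_absolutelyContinuous : wMeasure μ ≪ (volume : Measure (Sp N)) :=
  withDensity_absolutelyContinuous _ _

theorem isFiniteMeasure_wMeasure (hμ : IsProbDensity μ) : IsFiniteMeasure (wMeasure μ) :=
  isFiniteMeasure_withDensity_ofReal hμ.integrable.2

theorem ae_wMeasure_ne_zero (hN : N ≠ 0) : ∀ᵐ x ∂(wMeasure μ), x ≠ 0 := by
  have : Nonempty (Fin N) := ⟨⟨0, Nat.pos_of_ne_zero hN⟩⟩
  exact wMeasure_absolutelyContinuous.ae_le (Measure.ae_ne volume 0)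

theorem integrable_wMeasure_of_compact (hμ : IsProbDensity μ) {F : Type*} [NormedAddCommGroup F]
    {φ : Sp N → F} (h : Continuous φ) (h' : HasCompactSupport φ) :
    Integrable φ (wMeasure μ) := by
  have := isFiniteMeasure_wMeasure hμ
  exact h.integrable_of_hasCompactSupport h'

/-- Fatou's lemma for Bochner integrals. Integrability of the limit is part of the conclusion, since
a bound on the Bochner integral alone would be vacuous for a non-integrable function. -/
theorem integrable_and_integral_le_of_tendsto {α : Type*} [MeasurableSpace α] {ν : Measure α}
    {f : ℕ → α → ℝ} {g : α → ℝ} {c : ℕ → ℝ} {C : ℝ} (hf : ∀ n, Integrable (f n) ν)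
    (hpos : ∀ n, ∀ᵐ x ∂ν, 0 ≤ f n x) (hlim : ∀ᵐ x ∂ν, Tendsto (fun n => f n x) atTop (𝓝 (g x)))
    (hc : ∀ n, ∫ x, f n x ∂ν ≤ c n) (hC : Tendsto c atTop (𝓝 C)) :
    Integrable g ν ∧ ∫ x, g x ∂ν ≤ C := by
  have hgm : AEStronglyMeasurable g ν :=
    aestronglyMeasurable_of_tendsto_ae atTop (fun n => (hf n).1) hlim
  have hg0 : 0 ≤ᵐ[ν] g := by
    filter_upwards [ae_all_iff.2 hpos, hlim] with x h1 h2
    exact ge_of_tendsto' h2 h1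
  have hC0 : 0 ≤ C :=
    ge_of_tendsto' hC fun n => (integral_nonneg_of_ae (hpos n)).trans (hc n)
  have key : ∫⁻ x, ENNReal.ofReal (g x) ∂ν ≤ ENNReal.ofReal C := by
    calc ∫⁻ x, ENNReal.ofReal (g x) ∂ν
        = ∫⁻ x, liminf (fun n => ENNReal.ofReal (f n x)) atTop ∂ν := by
          refine lintegral_congr_ae ?_
          filter_upwards [hlim] with x hx
          exact ((ENNReal.continuous_ofReal.tendsto _).comp hx).liminf_eq.symm
      _ ≤ liminf (fun n => ∫⁻ x, ENNReal.ofReal (f n x) ∂ν) atTop :=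
          lintegral_liminf_le' fun n => (hf n).1.aemeasurable.ennreal_ofReal
      _ ≤ liminf (fun n => ENNReal.ofReal (c n)) atTop := by
          refine liminf_le_liminf (Eventually.of_forall fun n => ?_)
          rw [← ofReal_integral_eq_lintegral_ofReal (hf n) (hpos n)]
          exact ENNReal.ofReal_le_ofReal (hc n)
      _ = ENNReal.ofReal C := ((ENNReal.continuous_ofReal.tendsto _).comp hC).liminf_eq
  have hint : Integrable g ν := by
    refine ⟨hgm, ?_⟩
    rw [hasFiniteIntegral_iff_ofReal hg0]
    exact key.trans_lt ENNReal.ofReal_lt_top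
  refine ⟨hint, ?_⟩
  rwa [← ofReal_integral_eq_lintegral_ofReal hint hg0, ENNReal.ofReal_le_ofReal_iff hC0] at key

end Measure

/-! ### Weak derivative of a square, and of `μ = (√μ)²` -/

section ProductRule

open scoped Convolution

variable {N : ℕ}

/-- Translations act continuously on `L²`, and the correlation is an inner product with a translate.
-/
theorem continuous_correlation {f v : Sp N → ℝ} (hf : MemLp f 2) (hv : MemLp v 2) :
    Continuous fun y => ∫ x, f x * v (x - y) := by
  let g : C(Sp N, C(Sp N, Sp N)) :=
    (ContinuousMap.mk (fun p : Sp N × Sp N => p.2 - p.1) (by fun_prop)).curry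
  have hg : ∀ y, MeasurePreserving (g y) (volume : Measure (Sp N)) volume := fun y =>
    measurePreserving_sub_right volume y
  have key : Continuous fun y => Lp.compMeasurePreserving (g y) (hg y) (hv.toLp v) :=
    (continuous_const).compMeasurePreservingLp g.continuous hg (by simp)
  have h2 : Continuous fun y => inner ℝ (hf.toLp f)
      (Lp.compMeasurePreserving (g y) (hg y) (hv.toLp v)) := continuous_const.inner key
  refine h2.congr fun y => ?_
  rw [L2.inner_def]
  refine integral_congr_ae ?_
  filter_upwards [hf.coeFn_toLp, Lp.coeFn_compMeasurePreserving (hv.toLp v) (hg y),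
    (hg y).quasiMeasurePreserving.ae_eq_comp hv.coeFn_toLp] with x h1 h2 h3
  rw [h1, h2, h3]
  exact mul_comm _ _

/-- Fubini, with the integrable majorant `|ρ(t)| (f(x)² + v(x-t)²)`. -/
theorem integral_mul_convolution {ρ f v : Sp N → ℝ} (hρ : Continuous ρ) (hs : HasCompactSupport ρ)
    (hf : MemLp f 2) (hv : MemLp v 2) :
    ∫ x, f x * ∫ t, ρ t * v (x - t) = ∫ t, ρ t * ∫ x, f x * v (x - t) := by
  have hρi : Integrable ρ := hρ.integrable_of_hasCompactSupport hs
  have h1 : Integrable (fun p : Sp N × Sp N => f p.1 ^ 2 * ρ p.2) (volume.prod volume) :=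
    hf.integrable_sq.mul_prod hρi
  have h2 : Integrable (fun p : Sp N × Sp N => ρ p.2 * v (p.1 - p.2) ^ 2) (volume.prod volume) :=
    hρi.convolution_integrand (ContinuousLinearMap.mul ℝ ℝ) hv.integrable_sq
  have hm : AEStronglyMeasurable (fun p : Sp N × Sp N => f p.1 * (ρ p.2 * v (p.1 - p.2)))
      (volume.prod volume) :=
    hf.1.comp_fst.mul
      (hρi.1.convolution_integrand (ContinuousLinearMap.mul ℝ ℝ) hv.1)
  have h3 : Integrable (fun p : Sp N × Sp N => f p.1 * (ρ p.2 * v (p.1 - p.2)))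
      (volume.prod volume) := by
    refine (h1.norm.add h2.norm).mono' hm (Eventually.of_forall fun p => ?_)
    simp only [Pi.add_apply, norm_mul, Real.norm_eq_abs, norm_pow]
    nlinarith [mul_nonneg (abs_nonneg (ρ p.2)) (sq_nonneg (|f p.1| - |v (p.1 - p.2)|)),
      mul_nonneg (abs_nonneg (ρ p.2)) (sq_nonneg |f p.1|),
      mul_nonneg (abs_nonneg (ρ p.2)) (sq_nonneg |v (p.1 - p.2)|)]
  simp only [← integral_const_mul]
  rw [integral_integral_swap h3]
  refine integral_congr_ae (Eventually.of_forall fun t => ?_)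
  refine integral_congr_ae (Eventually.of_forall fun x => ?_)
  simp only
  ring

/-- Weak convergence of mollifications is all that the product rule needs. After Fubini it is the
mollification of the continuous correlation function, evaluated at the origin. -/
theorem tendsto_integral_mul_mollify {f v : Sp N → ℝ} (hf : MemLp f 2) (hv : MemLp v 2)
    {b : ℕ → ContDiffBump (0 : Sp N)} (hb : Tendsto (fun n => (b n).rOut) atTop (𝓝 0)) :
    Tendsto (fun n => ∫ x, f x * ∫ t, (b n).normed volume t * v (x - t)) atTop
      (𝓝 (∫ x, f x * v x)) := by
  have hc : Continuous fun y : Sp N => ∫ x, f x * v (x - -y) :=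
    (continuous_correlation hf hv).comp continuous_neg
  have := ContDiffBump.convolution_tendsto_right_of_continuous (μ := volume) hb hc 0
  simp only [convolution_def, neg_zero, sub_zero] at this
  refine this.congr fun n => ?_
  rw [integral_mul_convolution (b n).continuous_normed (b n).hasCompactSupport_normed hf hv]
  simp

/-- The derivative first falls on `ρ`; the weak derivative is then tested against `y ↦ ρ(x - y)`. -/
theorem HasWeakPartial.mollify {i : Fin N} {w g ρ : Sp N → ℝ} (h : HasWeakPartial i w g)
    (hρ : IsTest ρ) :
    ContDiff ℝ ∞ (fun x => ∫ t, ρ t * w (x - t)) ∧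
      ∀ x, partialD i (fun x => ∫ t, ρ t * w (x - t)) x = ∫ t, ρ t * g (x - t) := by
  have hrfl : (fun x => ∫ t, ρ t * w (x - t)) =
      ρ ⋆[ContinuousLinearMap.mul ℝ ℝ, volume] w := rfl
  refine ⟨?_, fun x => ?_⟩
  · rw [hrfl]
    exact hρ.2.contDiff_convolution_left _ hρ.1 h.1
  · have h1 := hρ.2.hasFDerivAt_convolution_left (ContinuousLinearMap.mul ℝ ℝ) (μ := volume)
      (hρ.1.of_le (by simp)) h.1 x
    have hcs : HasCompactSupport (fderiv ℝ ρ) := hρ.2.fderiv ℝ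
    have hce : ConvolutionExistsAt (fderiv ℝ ρ) w x
        ((ContinuousLinearMap.mul ℝ ℝ).precompL (Sp N)) volume :=
      hcs.convolutionExists_left _ (hρ.1.continuous_fderiv (by simp)) h.1 x
    rw [hrfl, partialD, h1.fderiv, convolution_def,
      ContinuousLinearMap.integral_apply hce]
    simp only [ContinuousLinearMap.precompL_apply, ContinuousLinearMap.mul_apply']
    have hψ : IsTest (fun y => ρ (x - y)) :=
      ⟨hρ.1.comp (contDiff_const.sub contDiff_id),
        hρ.2.comp_homeomorph (Homeomorph.subLeft x)⟩
    have h2 := h.2.2 _ hψ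
    have h3 : ∀ y, partialD i (fun y => ρ (x - y)) y = - partialD i ρ (x - y) := fun y => by
      have : HasFDerivAt (fun y => ρ (x - y))
          ((fderiv ℝ ρ (x - y)).comp (-ContinuousLinearMap.id ℝ (Sp N))) y :=
        (hρ.differentiable (x - y)).hasFDerivAt.comp y ((hasFDerivAt_id y).const_sub x)
      rw [partialD, this.fderiv]
      simp [partialD]
    simp only [h3, smul_eq_mul, neg_mul, integral_neg, neg_inj] at h2
    rw [← integral_sub_left_eq_self _ volume x,
      ← integral_sub_left_eq_self (fun t => ρ t * g (x - t)) volume x]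
    simpa [partialD] using h2

/-- Test the weak derivative of `w` against `φ · (ρₙ * w)`, which is smooth with compact support,
and let the mollifier concentrate. -/
theorem HasWeakPartial.integral_sq_of_memLp {i : Fin N} {w g φ : Sp N → ℝ}
    (h : HasWeakPartial i w g) (hw : MemLp w 2) (hg : MemLp g 2) (hφ : IsTest φ) :
    ∫ x, partialD i φ x * (w x * w x) = - ∫ x, φ x * (2 * (w x * g x)) := by
  let b : ℕ → ContDiffBump (0 : Sp N) := fun n =>
    ⟨1 / (2 * ((n : ℝ) + 1)), 1 / ((n : ℝ) + 1), by positivity, by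
      apply one_div_lt_one_div_of_lt <;> linarith [n.cast_nonneg (α := ℝ)]⟩
  have hb : Tendsto (fun n => (b n).rOut) atTop (𝓝 0) := tendsto_one_div_add_atTop_nhds_zero_nat
  have hρ : ∀ n, IsTest ((b n).normed volume) := fun n =>
    ⟨(b n).contDiff_normed, (b n).hasCompactSupport_normed⟩
  have hbdd : ∀ {ψ v : Sp N → ℝ}, IsTest ψ → MemLp v 2 → MemLp (fun x => ψ x * v x) 2 := by
    intro ψ v hψ hv
    obtain ⟨C, hC⟩ := hψ.2.exists_bound_of_continuous hψ.continuous
    refine hv.of_le_mul (c := C) (hψ.continuous.aestronglyMeasurable.mul hv.1)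
      (Eventually.of_forall fun x => ?_)
    rw [norm_mul]
    gcongr
    exact hC x
  have e : ∀ n, ∫ x, (partialD i φ x * w x) * ∫ t, (b n).normed volume t * w (x - t) =
      - ((∫ x, (φ x * w x) * ∫ t, (b n).normed volume t * g (x - t)) +
      ∫ x, (φ x * g x) * ∫ t, (b n).normed volume t * w (x - t)) := by
    intro n
    obtain ⟨hs, hd⟩ := h.mollify (hρ n)
    have hs' : ContDiff ℝ ∞ (fun x => ∫ t, (b n).normed volume t * g (x - t)) := by
      have := contDiff_partialD hs i
      rwa [funext hd] at this
    have h1 := h.2.2 _ (hφ.mul_right hs)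
    simp only [partialD_mul hφ.differentiable (hs.differentiable (by simp)), hd, smul_eq_mul,
      add_mul] at h1
    rw [integral_add] at h1
    · have e1 : ∀ x, partialD i φ x * (∫ t, (b n).normed volume t * w (x - t)) * w x =
        (partialD i φ x * w x) * ∫ t, (b n).normed volume t * w (x - t) := fun x => by ring
      have e2 : ∀ x, φ x * (∫ t, (b n).normed volume t * g (x - t)) * w x =
        (φ x * w x) * ∫ t, (b n).normed volume t * g (x - t) := fun x => by ring
      have e3 : ∀ x, φ x * (∫ t, (b n).normed volume t * w (x - t)) * g x =
        (φ x * g x) * ∫ t, (b n).normed volume t * w (x - t) := fun x => by ring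
      simp only [e1, e2, e3] at h1
      linarith
    · exact h.1.integrable_mul_test ((hφ.partialD i).mul_right hs).continuous
        ((hφ.partialD i).mul_right hs).2
    · exact h.1.integrable_mul_test (hφ.mul_right hs').continuous (hφ.mul_right hs').2
  have l1 := tendsto_integral_mul_mollify (hbdd (hφ.partialD i) hw) hw hb
  have l2 := tendsto_integral_mul_mollify (hbdd hφ hw) hg hb
  have l3 := tendsto_integral_mul_mollify (hbdd hφ hg) hw hb
  have := tendsto_nhds_unique l1 ((l2.add l3).neg.congr fun n => (e n).symm)
  simp only [mul_assoc] at this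
  rw [this, neg_inj, ← integral_add]
  · refine integral_congr_ae (Eventually.of_forall fun x => ?_)
    simp only
    ring
  · exact ((hbdd hφ hw).integrable_mul hg).congr (Eventually.of_forall fun x => mul_assoc _ _ _)
  · exact ((hbdd hφ hg).integrable_mul hw).congr (Eventually.of_forall fun x => mul_assoc _ _ _)

theorem LocMemLp.memLp_test_mul {v ζ : Sp N → ℝ} (hv : LocMemLp v 2) (hζ : IsTest ζ) :
    MemLp (fun x => ζ x * v x) 2 := by
  obtain ⟨C, hC⟩ := hζ.2.exists_bound_of_continuous hζ.continuous
  have hK : MeasurableSet (tsupport ζ) := (isClosed_tsupport ζ).measurableSet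
  have h1 : MemLp ((tsupport ζ).indicator v) 2 :=
    (memLp_indicator_iff_restrict hK).2 (hv _ hζ.2)
  have e : (fun x => ζ x * v x) = fun x => ζ x * (tsupport ζ).indicator v x := by
    funext x
    by_cases hx : x ∈ tsupport ζ
    · rw [Set.indicator_of_mem hx]
    · rw [image_eq_zero_of_notMem_tsupport hx, zero_mul, zero_mul]
  rw [e]
  refine h1.of_le_mul (c := C) (hζ.continuous.aestronglyMeasurable.mul h1.1)
    (Eventually.of_forall fun x => ?_)
  rw [norm_mul]
  gcongr
  exact hC x

theorem LocMemLp.locallyIntegrable_mul {v v' : Sp N → ℝ} (hv : LocMemLp v 2)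
    (hv' : LocMemLp v' 2) : LocallyIntegrable fun x => v x * v' x :=
  locallyIntegrable_iff.2 fun K hK => (hv K hK).integrable_mul (hv' K hK)

theorem HasWeakPartial.test_mul {i : Fin N} {w g ζ : Sp N → ℝ} (h : HasWeakPartial i w g)
    (hζ : IsTest ζ) :
    HasWeakPartial i (fun x => ζ x * w x) (fun x => partialD i ζ x * w x + ζ x * g x) := by
  have i1 := h.1.integrable_mul_test hζ.continuous hζ.2
  have i2 := h.1.integrable_mul_test (hζ.partialD i).continuous (hζ.partialD i).2
  have i3 := h.2.1.integrable_mul_test hζ.continuous hζ.2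
  refine ⟨i1.locallyIntegrable, (i2.add i3).locallyIntegrable, fun φ hφ => ?_⟩
  have t := h.2.2 _ (hφ.mul_right hζ.1)
  simp only [partialD_mul hφ.differentiable hζ.differentiable, smul_eq_mul, add_mul] at t
  have j1 := h.1.integrable_mul_test ((hφ.partialD i).mul_right hζ.1).continuous
    ((hφ.partialD i).mul_right hζ.1).2
  have j2 := h.1.integrable_mul_test (hφ.mul_right (hζ.partialD i).1).continuous
    (hφ.mul_right (hζ.partialD i).1).2
  have j3 := h.2.1.integrable_mul_test (hφ.mul_right hζ.1).continuous (hφ.mul_right hζ.1).2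
  rw [integral_add j1 j2] at t
  simp only [smul_eq_mul, mul_add, ← mul_assoc]
  rw [integral_add j2 j3]
  linarith

/-- Multiplying by a cut-off equal to `1` near the support of the test function reduces the local
statement to the global `L²` one. -/
theorem HasWeakPartial.sq {i : Fin N} {w g : Sp N → ℝ} (h : HasWeakPartial i w g)
    (hw : LocMemLp w 2) (hg : LocMemLp g 2) :
    HasWeakPartial i (fun x => w x * w x) (fun x => 2 * (w x * g x)) := by
  refine ⟨hw.locallyIntegrable_mul hw, (hw.locallyIntegrable_mul hg).smul (2 : ℝ),
    fun φ hφ => ?_⟩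
  obtain ⟨R, hR⟩ := hφ.2.isBounded.subset_closedBall (0 : Sp N)
  let ζ : ContDiffBump (0 : Sp N) := ⟨max R 0 + 1, max R 0 + 2, by positivity, by linarith⟩
  have hζ : IsTest ζ := ⟨ζ.contDiff, ζ.hasCompactSupport⟩
  have hin : ∀ x ∈ tsupport φ, ζ x = 1 ∧ partialD i ζ x = 0 := fun x hx => by
    have hx' : x ∈ Metric.ball (0 : Sp N) (max R 0 + 1) := by
      have := hR hx
      rw [mem_closedBall_zero_iff] at this
      rw [mem_ball_zero_iff]
      linarith [le_max_left R 0]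
    refine ⟨ζ.one_of_mem_closedBall (Metric.ball_subset_closedBall hx'), ?_⟩
    have : (ζ : Sp N → ℝ) =ᶠ[𝓝 x] fun _ => 1 :=
      ζ.eventuallyEq_one_of_mem_ball hx'
    rw [partialD, this.fderiv_eq]
    simp
  have hm : MemLp (fun x => partialD i ζ x * w x + ζ x * g x) 2 :=
    (hw.memLp_test_mul (hζ.partialD i)).add (hg.memLp_test_mul hζ)
  have key := (h.test_mul hζ).integral_sq_of_memLp (hw.memLp_test_mul hζ) hm hφ
  simp only [smul_eq_mul]
  convert key using 1
  · refine integral_congr_ae (Eventually.of_forall fun x => ?_)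
    by_cases hx : x ∈ tsupport φ
    · simp [(hin x hx).1]
    · have : partialD i φ x = 0 := by
        rw [partialD, fderiv_of_notMem_tsupport ℝ hx]
        rfl
      simp [this]
  · rw [neg_inj]
    refine integral_congr_ae (Eventually.of_forall fun x => ?_)
    by_cases hx : x ∈ tsupport φ
    · simp [hin x hx]
    · simp [image_eq_zero_of_notMem_tsupport hx]

theorem HasWeakPartial.congr_left {i : Fin N} {f f' g : Sp N → ℝ} (h : HasWeakPartial i f g)
    (hf : f =ᵐ[volume] f') : HasWeakPartial i f' g := by
  refine ⟨h.1.congr hf, h.2.1, fun φ hφ => ?_⟩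
  rw [← h.2.2 φ hφ]
  refine integral_congr_ae ?_
  filter_upwards [hf] with x hx
  rw [hx]

theorem HasWeakPartial.ae_eq {i : Fin N} {f g g' : Sp N → ℝ} (h : HasWeakPartial i f g)
    (h' : HasWeakPartial i f g') : g =ᵐ[volume] g' :=
  ae_eq_of_integral_contDiff_smul_eq h.2.1 h'.2.1 fun φ h1 h2 => by
    rw [← neg_inj, ← h.2.2 φ ⟨h1, h2⟩, ← h'.2.2 φ ⟨h1, h2⟩]

theorem HasWeakPartial.weakPartial {i : Fin N} {f g : Sp N → ℝ} (h : HasWeakPartial i f g) :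
    HasWeakPartial i f (weakPartial i f) := by
  have : ∃ g, HasWeakPartial i f g := ⟨g, h⟩
  rw [WeightedRellich.weakPartial, dif_pos this]
  exact this.choose_spec

theorem HasWeakLaplacian.weakLaplacian {f g : Sp N → ℝ} (h : HasWeakLaplacian f g) :
    HasWeakLaplacian f (weakLaplacian f) := by
  have : ∃ g, HasWeakLaplacian f g := ⟨g, h⟩
  rw [WeightedRellich.weakLaplacian, dif_pos this]
  exact this.choose_spec

/-- If `√μ ∈ H^1_loc` then `μ` has weak partial derivatives and `|∂_i μ|² = μ h` with
`0 ≤ h ∈ L^1_loc`, namely `h = 4 |∂_i √μ|²`. -/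
theorem weakPartial_of_sqrt_memH1loc {μ : Sp N → ℝ} (hμ : ∀ᵐ x, 0 ≤ μ x)
    (h : MemH1loc fun x => Real.sqrt (μ x)) (i : Fin N) :
    HasWeakPartial i μ (weakPartial i μ) ∧ ∃ k : Sp N → ℝ, LocallyIntegrable k ∧
      (∀ x, 0 ≤ k x) ∧ ∀ᵐ x, weakPartial i μ x ^ 2 = μ x * k x := by
  obtain ⟨hw, hd⟩ := h
  obtain ⟨g, hg, hg2⟩ := hd i
  have h1 := (hg.sq hw hg2).congr_left (f' := μ) (by
    filter_upwards [hμ] with x hx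
    exact Real.mul_self_sqrt hx)
  refine ⟨h1.weakPartial, fun x => 4 * (g x * g x),
    (hg2.locallyIntegrable_mul hg2).smul (4 : ℝ),
    fun x => by nlinarith [mul_self_nonneg (g x)], ?_⟩
  filter_upwards [h1.weakPartial.ae_eq h1, hμ] with x hx hx0
  rw [hx, mul_pow, mul_pow, Real.sq_sqrt hx0]
  ring

end ProductRule

/-! ### Sign of the Laplacian on the zero set -/

section ZeroSet

variable {N : ℕ}

/-- Lebesgue differentiation: the rescaled kernels live on balls of radius `1/l` and are bounded by
a multiple of the inverse volume. The exceptional null set depends only on `f`, not on `η`. -/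
theorem ae_tendsto_integral_rescale [NeZero N] {f : Sp N → ℝ} (hf : LocallyIntegrable f) :
    ∀ᵐ x₀, ∀ η : Sp N → ℝ, Continuous η → Function.support η ⊆ Metric.closedBall 0 1 →
      ∫ x, η x ≠ 0 → Tendsto (fun l : ℝ => l ^ N * ∫ x, η (l • (x - x₀)) * f x) atTop
        (𝓝 ((∫ x, η x) * f x₀)) := by
  filter_upwards [IsUnifLocDoublingMeasure.ae_tendsto_average_norm_sub volume hf 1] with x₀ hx₀
  intro η hη hs hI
  have hcs : HasCompactSupport η :=
    HasCompactSupport.of_support_subset_isCompact (isCompact_closedBall 0 1) hs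
  obtain ⟨C, hC⟩ := hcs.exists_bound_of_continuous hη
  have hδ : Tendsto (fun l : ℝ => l⁻¹) atTop (𝓝[>] 0) := tendsto_inv_atTop_nhdsGT_zero
  have hav := hx₀ (fun _ : ℝ => x₀) (fun l : ℝ => l⁻¹) hδ (by
    filter_upwards [eventually_gt_atTop 0] with l hl
    exact Metric.mem_closedBall_self (by positivity))
  have hvol : ∀ l : ℝ, 0 < l → volume.real (Metric.closedBall x₀ l⁻¹) =
      (l ^ N)⁻¹ * volume.real (Metric.closedBall (0 : Sp N) 1) := fun l hl => by
    rw [Measure.addHaar_real_closedBall' _ _ (by positivity), Measure.addHaar_real_closedBall' _ 0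
      zero_le_one]
    simp
  have hv1 : 0 < volume.real (Metric.closedBall (0 : Sp N) 1) :=
    ENNReal.toReal_pos (Metric.measure_closedBall_pos _ _ one_pos).ne' measure_closedBall_lt_top.ne
  -- The kernel is normalised to have integral `1`; this is where `∫ η ≠ 0` enters.
  have key := tendsto_integral_smul_of_tendsto_average_norm_sub
    (g := fun (l : ℝ) (x : Sp N) => (∫ x, η x)⁻¹ * (l ^ N * η (l • (x - x₀))))
    (C * volume.real (Metric.closedBall (0 : Sp N) 1) * |∫ x, η x|⁻¹) hav
    (Eventually.of_forall fun l => hf.integrableOn_isCompact (isCompact_closedBall _ _))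
    ?_ ?_ ?_
  · have := key.const_mul (∫ x, η x)
    refine this.congr fun l => ?_
    rw [← integral_const_mul, ← integral_const_mul]
    refine integral_congr_ae (Eventually.of_forall fun x => ?_)
    simp only [smul_eq_mul]
    field_simp
  · refine tendsto_const_nhds.congr' ?_
    filter_upwards [eventually_gt_atTop 0] with l hl
    rw [integral_const_mul, integral_const_mul,
      integral_sub_right_eq_self (fun x => η (l • x)) x₀, Measure.integral_comp_smul]
    simp only [finrank_euclideanSpace, Fintype.card_fin, smul_eq_mul]
    rw [abs_of_pos (by positivity)]
    field_simp
  · filter_upwards [eventually_gt_atTop 0] with l hl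
    intro x hx
    have : l • (x - x₀) ∈ Metric.closedBall (0 : Sp N) 1 := hs (by
      contrapose! hx
      simp only [Function.mem_support, ne_eq, not_not] at hx ⊢
      simp [hx])
    rw [mem_closedBall_zero_iff, norm_smul, Real.norm_of_nonneg hl.le] at this
    rw [mem_closedBall_iff_norm, ← one_div, le_div_iff₀ hl]
    linarith
  · filter_upwards [eventually_gt_atTop 0] with l hl
    intro x
    rw [hvol l hl, abs_mul, abs_mul, abs_inv, abs_of_pos (pow_pos hl N)]
    have := hC (l • (x - x₀))
    rw [Real.norm_eq_abs] at this
    have hI' : 0 < |∫ x, η x| := abs_pos.2 hI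
    rw [le_div_iff₀ (by positivity)]
    calc |∫ x, η x|⁻¹ * (l ^ N * |η (l • (x - x₀))|) *
          ((l ^ N)⁻¹ * volume.real (Metric.closedBall (0 : Sp N) 1))
        = |∫ x, η x|⁻¹ * |η (l • (x - x₀))| * volume.real (Metric.closedBall (0 : Sp N) 1) := by
          field_simp
      _ ≤ |∫ x, η x|⁻¹ * C * volume.real (Metric.closedBall (0 : Sp N) 1) := by gcongr
      _ = _ := by ring

theorem ae_tendsto_integral_rescale_of_nonneg [NeZero N] {f : Sp N → ℝ}
    (hf : LocallyIntegrable f) :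
    ∀ᵐ x₀, ∀ η : Sp N → ℝ, Continuous η → Function.support η ⊆ Metric.closedBall 0 1 →
      (∀ x, 0 ≤ η x) → Tendsto (fun l : ℝ => l ^ N * ∫ x, η (l • (x - x₀)) * f x) atTop
        (𝓝 ((∫ x, η x) * f x₀)) := by
  filter_upwards [ae_tendsto_integral_rescale hf] with x₀ h η hη hs h0
  by_cases hI : ∫ x, η x = 0
  · have hcs : HasCompactSupport η :=
      HasCompactSupport.of_support_subset_isCompact (isCompact_closedBall 0 1) hs
    have : η = 0 := (hη.ae_eq_iff_eq volume continuous_zero).1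
      ((integral_eq_zero_iff_of_nonneg h0 (hη.integrable_of_hasCompactSupport hcs)).1 hI)
    simp [this]
  · exact h η hη hs hI

theorem sum_coord_smul_stdVec (x : Sp N) : ∑ i, x i • stdVec i = x := by
  have := (EuclideanSpace.basisFun (Fin N) ℝ).sum_repr x
  simpa [stdVec] using this

theorem partialD_affine {g : Sp N → ℝ} (hg : Differentiable ℝ g) (l : ℝ) (x₀ : Sp N) (i : Fin N) :
    partialD i (fun x => g (l • (x - x₀))) = fun x => l * partialD i g (l • (x - x₀)) := by
  funext x
  have : HasFDerivAt (fun x => g (l • (x - x₀)))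
      ((fderiv ℝ g (l • (x - x₀))).comp (l • ContinuousLinearMap.id ℝ (Sp N))) x :=
    (hg _).hasFDerivAt.comp x (((hasFDerivAt_id x).sub_const x₀).const_smul l)
  rw [partialD, this.fderiv]
  simp [partialD]

/-- For a radial bump `κ` with `∇κ = - m x`, the `λ`-derivative of the averages
`λ^N ∫ m(λ(x-x₀)) f(x) dx` is `- λ^{N-3} ∫ κ(λ(x-x₀)) Δf(x) dx`. -/
theorem hasDerivAt_integral_rescale {κ m f D : Sp N → ℝ} (hκ : IsTest κ) (hm : IsTest m)
    (hmκ : ∀ i x, partialD i κ x = - (m x * x i)) (hf : Integrable f)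
    (hD : HasWeakLaplacian f D) (x₀ : Sp N) {l : ℝ} (hl : 0 < l) :
    HasDerivAt (fun l : ℝ => l ^ N * ∫ x, m (l • (x - x₀)) * f x)
      (- (l ^ 3)⁻¹ * (l ^ N * ∫ x, κ (l • (x - x₀)) * D x)) l := by
  -- `Δκ = -div(m x)`, and the same combination `N m + y · ∇m` appears when `l^N m(l(x - x₀))` is
  -- differentiated in `l`.
  have hlap : ∀ y, Laplacian.laplacian κ y = - (N * m y + fderiv ℝ m y y) := fun y => by
    rw [laplacian_eq_sum hκ.1]
    have : ∀ i : Fin N, partialD i (partialD i κ) y =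
        - (m y + y i * fderiv ℝ m y (stdVec i)) := fun i => by
      rw [show partialD i κ = fun x => (-1 : ℝ) * (m x * x i) by
        funext x; rw [hmκ]; ring]
      have hc := (contDiff_coord i).differentiable (by simp : (∞ : WithTop ℕ∞) ≠ 0)
      rw [partialD_mul (differentiable_const _) (hm.differentiable.fun_mul hc),
        partialD_mul hm.differentiable hc, partialD_coord]
      simp only [partialD, fderiv_fun_const]
      simp
      ring
    simp only [this, Finset.sum_neg_distrib, Finset.sum_add_distrib]
    have e := congrArg (fderiv ℝ m y) (sum_coord_smul_stdVec y)
    simp only [map_sum, map_smul, smul_eq_mul] at e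
    simp [← e]
  have hcomp : ∀ g : Sp N → ℝ, Continuous g → ∀ l : ℝ,
      Continuous fun x => g (l • (x - x₀)) := fun g hg l => by fun_prop
  have hlapc : Continuous (Laplacian.laplacian κ) := by
    rw [funext hlap]
    have := (hm.1.continuous_fderiv (by simp)).clm_apply continuous_id
    exact ((continuous_const.mul hm.continuous).add this).neg
  have hlaps : HasCompactSupport (Laplacian.laplacian κ) := by
    refine hm.2.mono' fun x hx => ?_
    contrapose! hx
    rw [Function.mem_support, not_not, hlap, image_eq_zero_of_notMem_tsupport hx,
      fderiv_of_notMem_tsupport ℝ hx]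
    simp
  obtain ⟨C, hC⟩ := hlaps.exists_bound_of_continuous hlapc
  obtain ⟨M, hM⟩ := hm.2.exists_bound_of_continuous hm.continuous
  have hder : ∀ x : Sp N, ∀ l : ℝ, 0 < l → HasDerivAt (fun l : ℝ => l ^ N * m (l • (x - x₀)) * f x)
      (- (l⁻¹ * l ^ N * Laplacian.laplacian κ (l • (x - x₀))) * f x) l := fun x l hl => by
    have h1 : HasDerivAt (fun l : ℝ => m (l • (x - x₀)))
        (fderiv ℝ m (l • (x - x₀)) ((1 : ℝ) • (x - x₀))) l :=
      (hm.differentiable _).hasFDerivAt.comp_hasDerivAt l ((hasDerivAt_id l).smul_const _)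
    have h2 := ((hasDerivAt_pow N l).mul h1).mul_const (f x)
    refine h2.congr_deriv ?_
    rw [hlap, one_smul, map_smul, smul_eq_mul]
    rcases N with _ | n
    · simp [hl.ne']
    · simp only [Nat.add_sub_cancel, pow_succ]
      field_simp
  have hint := hasDerivAt_integral_of_dominated_loc_of_deriv_le (μ := volume)
    (F := fun (l : ℝ) (x : Sp N) => l ^ N * m (l • (x - x₀)) * f x)
    (F' := fun l x => - (l⁻¹ * l ^ N * Laplacian.laplacian κ (l • (x - x₀))) * f x)
    (x₀ := l) (s := Metric.ball l (l / 2)) (bound := fun x => (2 / l) * (2 * l) ^ N * C * ‖f x‖)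
    (Metric.ball_mem_nhds l (by positivity))
    (Eventually.of_forall fun l => ((hcomp m hm.continuous l).const_mul _).aestronglyMeasurable.mul
      hf.1)
    (hf.bdd_mul (c := l ^ N * M) ((hcomp m hm.continuous l).const_mul _).aestronglyMeasurable
      (Eventually.of_forall fun x => by
        rw [norm_mul, Real.norm_of_nonneg (by positivity)]
        gcongr
        exact hM _))
    (((hcomp _ hlapc l).const_mul _).neg.aestronglyMeasurable.mul hf.1)
    (Eventually.of_forall fun x t ht => by
      rw [Metric.mem_ball, Real.dist_eq, abs_lt] at ht
      have ht0 : l / 2 < t := by linarith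
      have ht1 : t ≤ 2 * l := by linarith
      have htpos : 0 < t := by linarith
      rw [norm_mul, norm_neg, norm_mul, norm_mul, norm_inv, norm_pow,
        Real.norm_of_nonneg htpos.le]
      have : t⁻¹ ≤ 2 / l := by
        rw [inv_le_comm₀ htpos (by positivity), inv_div]
        exact ht0.le
      gcongr
      exact hC _)
    (hf.norm.const_mul _)
    (Eventually.of_forall fun x t ht => by
      rw [Metric.mem_ball, Real.dist_eq, abs_lt] at ht
      exact hder x t (by linarith))
  have hψ : IsTest fun x => κ (l • (x - x₀)) := by
    refine ⟨hκ.1.comp (by fun_prop), ?_⟩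
    exact hκ.2.comp_homeomorph ((Homeomorph.subRight x₀).trans (Homeomorph.smulOfNeZero l hl.ne'))
  have hΔ : ∀ x, Laplacian.laplacian (fun x => κ (l • (x - x₀))) x =
      l ^ 2 * Laplacian.laplacian κ (l • (x - x₀)) := fun x => by
    rw [laplacian_eq_sum hψ.1, laplacian_eq_sum hκ.1, Finset.mul_sum]
    refine Finset.sum_congr rfl fun i _ => ?_
    rw [partialD_affine hκ.differentiable]
    have hd := (hκ.partialD i).differentiable
    rw [partialD_mul (differentiable_const l) (g := fun x => partialD i κ (l • (x - x₀)))
      (hd.comp ((differentiable_id.sub_const x₀).const_smul l)), partialD_affine hd]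
    simp only [partialD, fderiv_fun_const]
    simp
    ring
  have hw := hD.2.2 _ hψ
  simp only [hΔ] at hw
  have e : (fun l : ℝ => l ^ N * ∫ x, m (l • (x - x₀)) * f x) =
      fun l : ℝ => ∫ x, l ^ N * m (l • (x - x₀)) * f x := by
    funext t
    rw [← integral_const_mul]
    simp only [mul_assoc]
  rw [e]
  refine hint.2.congr_deriv ?_
  rw [← hw, ← integral_const_mul, ← integral_const_mul]
  refine integral_congr_ae (Eventually.of_forall fun x => ?_)
  simp only
  field_simp

/-- A nonnegative function whose distributional Laplacian is locally integrable has nonnegative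
Laplacian at almost every zero. -/
theorem weakLaplacian_nonneg_of_eq_zero [NeZero N] {f D : Sp N → ℝ} (hf : Integrable f)
    (hf0 : ∀ᵐ x, 0 ≤ f x) (hD : HasWeakLaplacian f D) : ∀ᵐ x, f x = 0 → 0 ≤ D x := by
  -- A nonincreasing profile, so that `κ = k(|x|²)` and `m = -2 k'(|x|²)` are both nonnegative and
  -- supported in the unit ball.
  have hk : ContDiff ℝ ∞ fun t : ℝ => Real.smoothTransition (1 - t) :=
    Real.smoothTransition.contDiff.comp (contDiff_const.sub contDiff_id)
  set k : ℝ → ℝ := fun t => Real.smoothTransition (1 - t) with hkdef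
  have hk' : ContDiff ℝ ∞ (deriv k) := (contDiff_infty_iff_deriv.1 hk).2
  have hanti : Antitone k := fun a b hab =>
    Real.smoothTransition.monotone (by linarith)
  have hk0 : ∀ t, 1 < t → k =ᶠ[𝓝 t] fun _ => 0 := fun t ht => by
    filter_upwards [lt_mem_nhds ht] with s hs
    exact Real.smoothTransition.zero_of_nonpos (by linarith)
  have hnorm : ContDiff ℝ ∞ fun x : Sp N => ‖x‖ ^ 2 := contDiff_norm_sq ℝ
  have hball : ∀ b : ℝ → ℝ, (∀ t, 1 < t → b t = 0) →
      Function.support (fun x : Sp N => b (‖x‖ ^ 2)) ⊆ Metric.closedBall 0 1 := fun b hb x hx => by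
    contrapose! hx
    rw [mem_closedBall_zero_iff, not_le] at hx
    rw [Function.mem_support, not_not]
    exact hb _ (by nlinarith)
  let κ : Sp N → ℝ := fun x => k (‖x‖ ^ 2)
  let m : Sp N → ℝ := fun x => -2 * deriv k (‖x‖ ^ 2)
  have sκ : Function.support κ ⊆ Metric.closedBall 0 1 := hball k fun t ht => (hk0 t ht).self_of_nhds
  have sm : Function.support m ⊆ Metric.closedBall 0 1 := hball (fun t => -2 * deriv k t)
    fun t ht => by rw [(hk0 t ht).deriv_eq]; simp
  have hκ : IsTest κ := ⟨hk.comp hnorm,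
    HasCompactSupport.of_support_subset_isCompact (isCompact_closedBall 0 1) sκ⟩
  have hm : IsTest m := ⟨contDiff_const.mul (hk'.comp hnorm),
    HasCompactSupport.of_support_subset_isCompact (isCompact_closedBall 0 1) sm⟩
  have hκ0 : ∀ x, 0 ≤ κ x := fun x => Real.smoothTransition.nonneg _
  have hm0 : ∀ x, 0 ≤ m x := fun x => by
    have := hanti.deriv_nonpos (x := ‖x‖ ^ 2)
    simp only [m]
    linarith
  have hmκ : ∀ i x, partialD i κ x = - (m x * x i) := fun i x => by
    rw [partialD_radial (b := k) ((hk.differentiable (by simp) _).hasDerivAt)]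
    simp only [m]
    ring
  have hκI : 0 < ∫ x, κ x := by
    refine hκ.continuous.integral_pos_of_hasCompactSupport_nonneg_nonzero hκ.2 hκ0 (x := 0) ?_
    simp [κ, k]
  filter_upwards [ae_tendsto_integral_rescale_of_nonneg hf.locallyIntegrable,
    ae_tendsto_integral_rescale_of_nonneg hD.2.1] with x₀ h1 h2 hx₀
  -- If `D x₀ < 0`, the averages `Ψ` of `f` at scale `1/l` are eventually strictly increasing in
  -- `l`. They are nonnegative there, yet tend to a multiple of `f x₀ = 0`, which is impossible.
  by_contra! hneg
  have l1 := h1 m hm.continuous sm hm0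
  have l2 := h2 κ hκ.continuous sκ hκ0
  rw [hx₀, mul_zero] at l1
  have hlt : (∫ x, κ x) * D x₀ < 0 := mul_neg_of_pos_of_neg hκI hneg
  obtain ⟨Λ, hΛ⟩ := eventually_atTop.1 ((tendsto_order.1 l2).2 0 hlt)
  set Ψ : ℝ → ℝ := fun l => l ^ N * ∫ x, m (l • (x - x₀)) * f x with hΨ
  have hd : ∀ l, 0 < l → HasDerivAt Ψ _ l := fun l hl =>
    hasDerivAt_integral_rescale hκ hm hmκ hf hD x₀ hl
  set A := max Λ 1
  have hA : 0 < A := lt_of_lt_of_le one_pos (le_max_right _ _)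
  have hmono : StrictMonoOn Ψ (Set.Ici A) := by
    refine strictMonoOn_of_deriv_pos (convex_Ici A)
      (fun l hl => (hd l (hA.trans_le hl)).continuousAt.continuousWithinAt) fun l hl => ?_
    rw [interior_Ici] at hl
    have hl0 : 0 < l := hA.trans hl
    rw [(hd l hl0).deriv]
    have := hΛ l ((le_max_left _ _).trans (le_of_lt hl))
    exact mul_pos_of_neg_of_neg (by simp; positivity) this
  have hΨ0 : 0 ≤ Ψ A := mul_nonneg (by positivity) (integral_nonneg_of_ae (by
    filter_upwards [hf0] with x hx
    exact mul_nonneg (hm0 _) hx))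
  have hA1 : Ψ A < Ψ (A + 1) := hmono Set.self_mem_Ici (by simp) (by simp)
  have : Ψ (A + 1) ≤ 0 := by
    refine ge_of_tendsto l1 ?_
    filter_upwards [eventually_ge_atTop (A + 1)] with l hl
    exact hmono.monotoneOn (by simp) (by simp; linarith) hl
  linarith

end ZeroSet

/-! ### The drift and the completed square -/

section Drift

variable {N : ℕ} {μ : Sp N → ℝ}

theorem aestronglyMeasurable_drift (hμ : IsProbDensity μ) (h2 : HypH2 μ) (i : Fin N) :
    AEStronglyMeasurable (drift μ i) :=
  ((weakPartial_of_sqrt_memH1loc hμ.nonneg h2.sqrt_memH1loc i).1.2.1.aestronglyMeasurable.aemeasurable.div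
    hμ.integrable.aemeasurable).aestronglyMeasurable

/-- The quotient loses nothing on `{μ = 0}`: from `|∂ᵢμ|² = μ k` the weak derivative vanishes there
almost everywhere. -/
theorem hasWeakPartial_mul_drift (hμ : IsProbDensity μ) (h2 : HypH2 μ) (i : Fin N) :
    HasWeakPartial i μ (fun x => μ x * drift μ i x) := by
  obtain ⟨h, k, -, -, hk⟩ := weakPartial_of_sqrt_memH1loc hμ.nonneg h2.sqrt_memH1loc i
  have e : weakPartial i μ =ᵐ[volume] fun x => μ x * drift μ i x := by
    filter_upwards [hk] with x hx
    by_cases h0 : μ x = 0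
    · rw [h0, zero_mul] at hx
      rw [h0, zero_mul, pow_eq_zero_iff two_ne_zero |>.1 hx]
    · rw [drift]
      field_simp
  refine ⟨h.1, h.2.1.congr e, fun φ hφ => ?_⟩
  rw [h.2.2 φ hφ, neg_inj]
  refine integral_congr_ae ?_
  filter_upwards [e] with x hx
  rw [hx]

/-- Where `μ > 0`, the function is `|∂ᵢμ|²/μ = k`, with `k` locally integrable because `√μ ∈
H¹_loc`. -/
theorem locallyIntegrable_mul_drift_sq (hμ : IsProbDensity μ) (h2 : HypH2 μ) (i : Fin N) :
    LocallyIntegrable (fun x => μ x * drift μ i x ^ 2) := by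
  obtain ⟨h, k, hk1, hk0, hk⟩ := weakPartial_of_sqrt_memH1loc hμ.nonneg h2.sqrt_memH1loc i
  refine hk1.mono (hμ.integrable.1.mul ((aestronglyMeasurable_drift hμ h2 i).pow 2)) ?_
  filter_upwards [hk] with x hx
  by_cases h0 : μ x = 0
  · simp [h0]
  · rw [drift, div_pow, hx]
    have : μ x * (μ x * k x / μ x ^ 2) = k x := by field_simp
    rw [this]

theorem integral_partialD_mul_density (hμ : IsProbDensity μ) (h2 : HypH2 μ) {ψ : Sp N → ℝ}
    (hψ : IsTest ψ) (i : Fin N) :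
    ∫ x, partialD i ψ x * μ x = - ∫ x, ψ x * (μ x * drift μ i x) :=
  (hasWeakPartial_mul_drift hμ h2 i).2.2 ψ hψ

theorem integrable_test_mul_density (hμ : IsProbDensity μ) {ψ : Sp N → ℝ}
    (hψ : IsTest ψ) : Integrable fun x => ψ x * μ x :=
  hμ.integrable.locallyIntegrable.integrable_mul_test hψ.continuous hψ.2

theorem integrable_test_mul_drift (hμ : IsProbDensity μ) (h2 : HypH2 μ) {ψ : Sp N → ℝ}
    (hψ : IsTest ψ) (i : Fin N) : Integrable fun x => ψ x * (μ x * drift μ i x) :=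
  (hasWeakPartial_mul_drift hμ h2 i).2.1.integrable_mul_test hψ.continuous hψ.2

theorem integrable_test_mul_drift_sq (hμ : IsProbDensity μ) (h2 : HypH2 μ) {ψ : Sp N → ℝ}
    (hψ : IsTest ψ) (i : Fin N) : Integrable fun x => ψ x * (μ x * drift μ i x ^ 2) :=
  (locallyIntegrable_mul_drift_sq hμ h2 i).integrable_mul_test hψ.continuous hψ.2

/-- Integrate `0 ≤ |∂ᵢφ + (F + ∂ᵢμ/(2μ)) φ|² μ`. With `q = |φ|²`, the terms `F ∂ᵢq μ + F q ∂ᵢμ`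
integrate to `-∫ (∂ᵢF) q μ`, and `½ ∂ᵢq ∂ᵢμ` to `-½ ∫ (∂ᵢ∂ᵢq) μ`. -/
theorem integral_vectorField_component_le (hμ : IsProbDensity μ) (h2 : HypH2 μ) {φ : Sp N → ℂ}
    (hφ : IsTest φ) {F : Sp N → ℝ} (hF : ContDiff ℝ ∞ F) (i : Fin N) :
    ∫ x, ((partialD i F x - F x ^ 2) * ‖φ x‖ ^ 2) * μ x ≤
      (∫ x, ‖partialD i φ x‖ ^ 2 * μ x)
        - (1 / 2) * (∫ x, partialD i (partialD i fun y => ‖φ y‖ ^ 2) x * μ x)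
        + (1 / 4) * ∫ x, ‖φ x‖ ^ 2 * (μ x * drift μ i x ^ 2) := by
  have hq := hφ.norm_sq
  have hdq := hq.partialD i
  have hFq := hq.mul_left hF
  have hF2 : ContDiff ℝ ∞ fun x => F x ^ 2 := hF.pow 2
  have hFd := contDiff_partialD hF i
  have e1 := integral_partialD_mul_density hμ h2 hFq i
  have e2 := integral_partialD_mul_density hμ h2 hdq i
  simp only [partialD_mul (hF.differentiable (by simp)) hq.differentiable, add_mul] at e1
  have i1 := integrable_test_mul_density hμ (hq.mul_left hFd)
  have i2 := integrable_test_mul_density hμ (hdq.mul_left hF)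
  have i3 := integrable_test_mul_density hμ (hq.mul_left hF2)
  have i4 := integrable_test_mul_density hμ (hφ.partialD i).norm_sq
  have i5 := integrable_test_mul_drift hμ h2 hFq i
  have i6 := integrable_test_mul_drift hμ h2 hdq i
  have i7 := integrable_test_mul_drift_sq hμ h2 hq i
  rw [integral_add i1 i2] at e1
  have pos : 0 ≤ ∫ x, ((((‖partialD i φ x‖ ^ 2 * μ x
      + (F x * partialD i (fun y => ‖φ y‖ ^ 2) x) * μ x)
      + (1 / 2) * (partialD i (fun y => ‖φ y‖ ^ 2) x * (μ x * drift μ i x)))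
      + (F x ^ 2 * ‖φ x‖ ^ 2) * μ x)
      + (F x * ‖φ x‖ ^ 2) * (μ x * drift μ i x))
      + (1 / 4) * (‖φ x‖ ^ 2 * (μ x * drift μ i x ^ 2)) := by
    refine integral_nonneg_of_ae ?_
    filter_upwards [hμ.nonneg] with x hx
    have h := mul_nonneg (sq_nonneg ‖partialD i φ x + (F x + drift μ i x / 2) • φ x‖) hx
    rw [norm_add_sq_real, inner_smul_right, real_inner_comm, norm_smul, mul_pow,
      Real.norm_eq_abs, sq_abs] at h
    rw [partialD_norm_sq hφ.differentiable]
    simp only [Pi.zero_apply]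
    linarith
  have j1 : Integrable fun x => ‖partialD i φ x‖ ^ 2 * μ x +
      (F x * partialD i (fun y => ‖φ y‖ ^ 2) x) * μ x := i4.add i2
  have j2 := i6.const_mul (1 / 2)
  have j3 : Integrable fun x => (‖partialD i φ x‖ ^ 2 * μ x +
      (F x * partialD i (fun y => ‖φ y‖ ^ 2) x) * μ x) +
      (1 / 2) * (partialD i (fun y => ‖φ y‖ ^ 2) x * (μ x * drift μ i x)) := j1.add j2
  have j4 : Integrable fun x => ((‖partialD i φ x‖ ^ 2 * μ x +
      (F x * partialD i (fun y => ‖φ y‖ ^ 2) x) * μ x) +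
      (1 / 2) * (partialD i (fun y => ‖φ y‖ ^ 2) x * (μ x * drift μ i x))) +
      (F x ^ 2 * ‖φ x‖ ^ 2) * μ x := j3.add i3
  have j5 : Integrable fun x => (((‖partialD i φ x‖ ^ 2 * μ x +
      (F x * partialD i (fun y => ‖φ y‖ ^ 2) x) * μ x) +
      (1 / 2) * (partialD i (fun y => ‖φ y‖ ^ 2) x * (μ x * drift μ i x))) +
      (F x ^ 2 * ‖φ x‖ ^ 2) * μ x) +
      (F x * ‖φ x‖ ^ 2) * (μ x * drift μ i x) := j4.add i5
  rw [integral_add j5 (i7.const_mul _), integral_add j4 i5, integral_add j3 i3,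
    integral_add j1 j2, integral_add i4 i2,
    integral_const_mul, integral_const_mul] at pos
  have lhs : ∫ x, ((partialD i F x - F x ^ 2) * ‖φ x‖ ^ 2) * μ x =
      (∫ x, partialD i F x * ‖φ x‖ ^ 2 * μ x) - ∫ x, F x ^ 2 * ‖φ x‖ ^ 2 * μ x := by
    rw [← integral_sub i1 i3]
    refine integral_congr_ae (Eventually.of_forall fun x => ?_)
    simp only
    ring
  rw [lhs]
  linarith

/-- Completing the square with the vector field `F + ∇μ/(2μ)`. -/
theorem integral_vectorField_le (hμ : IsProbDensity μ) (h2 : HypH2 μ) {φ : Sp N → ℂ}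
    (hφ : IsTest φ) {F : Fin N → Sp N → ℝ} (hF : ∀ i, ContDiff ℝ ∞ (F i)) :
    Integrable (fun x => ‖φ x‖ ^ 2 *
        ((1 / 4) * ∑ i, μ x * drift μ i x ^ 2 - (1 / 2) * weakLaplacian μ x)) ∧
    ∫ x, ((∑ i, partialD i (F i) x - ∑ i, F i x ^ 2) * ‖φ x‖ ^ 2) * μ x ≤
      (∫ x, (∑ i, ‖partialD i φ x‖ ^ 2) * μ x) + ∫ x, ‖φ x‖ ^ 2 *
        ((1 / 4) * ∑ i, μ x * drift μ i x ^ 2 - (1 / 2) * weakLaplacian μ x) := by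
  have hq := hφ.norm_sq
  obtain ⟨g, hg⟩ := h2.laplacian_mem
  have hD := hg.weakLaplacian
  have i1 : ∀ i, Integrable fun x => ((partialD i (F i) x - F i x ^ 2) * ‖φ x‖ ^ 2) * μ x :=
    fun i => integrable_test_mul_density hμ
      (hq.mul_left ((contDiff_partialD (hF i) i).sub ((hF i).pow 2)))
  have i2 := fun i => integrable_test_mul_density hμ (hφ.partialD i).norm_sq
  have i3 := fun i => integrable_test_mul_density hμ ((hq.partialD i).partialD i)
  have i4 := fun i => (integrable_test_mul_drift_sq hμ h2 hq i).const_mul (1 / 4)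
  have i5 := (hD.2.1.integrable_mul_test hq.continuous hq.2).const_mul (1 / 2)
  have eW : (fun x => ‖φ x‖ ^ 2 *
      ((1 / 4) * ∑ i, μ x * drift μ i x ^ 2 - (1 / 2) * weakLaplacian μ x)) =
      fun x => (∑ i, (1 / 4) * (‖φ x‖ ^ 2 * (μ x * drift μ i x ^ 2))) -
        (1 / 2) * (‖φ x‖ ^ 2 * weakLaplacian μ x) := by
    funext x
    simp only [← Finset.mul_sum]
    ring
  have iW := (integrable_finsetSum Finset.univ fun i _ => i4 i).sub i5
  rw [eW]
  refine ⟨iW, ?_⟩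
  have hlap := hD.2.2 _ hq
  simp only [laplacian_eq_sum hq.1, Finset.sum_mul] at hlap
  rw [integral_finsetSum _ fun i _ => i3 i] at hlap
  have hsum := Finset.sum_le_sum fun i (_ : i ∈ Finset.univ) =>
    integral_vectorField_component_le hμ h2 hφ (hF i) i
  simp only [Finset.sum_add_distrib, Finset.sum_sub_distrib, ← Finset.mul_sum] at hsum
  rw [hlap, ← integral_finsetSum _ fun i _ => i1 i, ← integral_finsetSum _ fun i _ => i2 i] at hsum
  rw [integral_sub (integrable_finsetSum Finset.univ fun i _ => i4 i) i5,
    integral_finsetSum _ fun i _ => i4 i]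
  simp only [integral_const_mul, ← Finset.mul_sum]
  have e : ∀ x, ∑ i, (partialD i (F i) x - F i x ^ 2) * ‖φ x‖ ^ 2 * μ x =
      (∑ i, partialD i (F i) x - ∑ i, F i x ^ 2) * ‖φ x‖ ^ 2 * μ x := fun x => by
    rw [← Finset.sum_sub_distrib, Finset.sum_mul, Finset.sum_mul]
  simp only [e] at hsum
  simp only [Finset.sum_mul]
  linarith

end Drift

/-! ### The radial Hardy field with logarithmic correction -/

section Radial

/-- The logarithmic correction in the radial Hardy vector field. -/
def logWeight (t : ℝ) : ℝ := (Real.log (Real.exp 1 + t⁻¹))⁻¹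

theorem one_le_log_exp_add {t : ℝ} (ht : 0 < t) : 1 ≤ Real.log (Real.exp 1 + t⁻¹) := by
  rw [Real.le_log_iff_exp_le (by positivity)]
  linarith [inv_pos.2 ht]

theorem logWeight_pos {t : ℝ} (ht : 0 < t) : 0 < logWeight t :=
  inv_pos.2 (one_pos.trans_le (one_le_log_exp_add ht))

theorem logWeight_le_one {t : ℝ} (ht : 0 < t) : logWeight t ≤ 1 :=
  inv_le_one_of_one_le₀ (one_le_log_exp_add ht)

theorem hasDerivAt_logWeight {t : ℝ} (ht : 0 < t) :
    HasDerivAt logWeight (logWeight t ^ 2 / (t * (1 + Real.exp 1 * t))) t := by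
  have hl := one_pos.trans_le (one_le_log_exp_add ht)
  have h := (((hasDerivAt_inv ht.ne').const_add (Real.exp 1)).log (by positivity)).inv hl.ne'
  refine h.congr_deriv ?_
  have := Real.exp_pos 1
  rw [logWeight]
  field_simp
  ring

theorem contDiffAt_logWeight {t : ℝ} (ht : 0 < t) : ContDiffAt ℝ ∞ logWeight t :=
  ((contDiffAt_const.add (contDiffAt_inv ℝ ht.ne')).log (by positivity)).inv
    (one_pos.trans_le (one_le_log_exp_add ht)).ne'

/-- The radial potential `div F - |F|²` obtained from the regularised Hardy vector field. -/
def radialPot (N : ℕ) (δ s : ℝ) : ℝ :=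
  (N * (((N : ℝ) - 2) / 2 + logWeight (s + δ)) * δ +
    s * (hardyC N + logWeight (s + δ) ^ 2 * (2 / (1 + Real.exp 1 * (s + δ)) - 1))) / (s + δ) ^ 2

/-- The correction costs at most `1` because `0 < logWeight t ≤ 1`. This crude bound holds at every
radius; since `C₀ > 1` for `N ≥ 5`, it supplies the positivity needed for Fatou. -/
theorem radialPot_core_ge {N : ℕ} {t : ℝ} (ht : 0 < t) :
    hardyC N - 1 ≤ hardyC N + logWeight t ^ 2 * (2 / (1 + Real.exp 1 * t) - 1) := by
  have h1 := logWeight_pos ht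
  have h2 := logWeight_le_one ht
  have h3 : 0 ≤ 2 / (1 + Real.exp 1 * t) := by positivity
  nlinarith [mul_nonneg (sq_nonneg (logWeight t)) h3]

theorem hardyC_ge {N : ℕ} (hN : 5 ≤ N) : 9 / 4 ≤ hardyC N := by
  have : (5 : ℝ) ≤ N := by exact_mod_cast hN
  rw [hardyC]
  nlinarith

theorem radialPot_nonneg {N : ℕ} (hN : 5 ≤ N) {δ s : ℝ} (hδ : 0 < δ) (hs : 0 ≤ s) :
    0 ≤ radialPot N δ s := by
  have ht : 0 < s + δ := by positivity
  have hN' : (5 : ℝ) ≤ N := by exact_mod_cast hN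
  have h1 := radialPot_core_ge (N := N) ht
  have h2 := hardyC_ge hN
  have h3 := logWeight_pos ht
  refine div_nonneg (add_nonneg ?_ (mul_nonneg hs (by linarith))) (by positivity)
  exact mul_nonneg (mul_nonneg (by positivity) (by linarith)) hδ.le

theorem radialPot_zero_ge {N : ℕ} {s : ℝ} (hs : 0 < s) :
    (hardyC N - 1) / s ≤ radialPot N 0 s := by
  have h1 := radialPot_core_ge (N := N) hs
  rw [radialPot, add_zero, mul_zero, zero_add, sq (s : ℝ), mul_div_mul_left _ _ hs.ne']
  gcongr

/-- Near `0`, `logWeight s = 1/(|log s| + log(1 + e s))` differs little from `1/|log s|`. Replacing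
its square by `1/log² s` costs `2 e s`, replacing the factor `2/(1 + e s) - 1` by `1` costs another
`2 e s`, and division by `s` leaves `4 e`. -/
theorem radialPot_zero_ge_log {N : ℕ} {s : ℝ} (hs : 0 < s) (hs1 : s < Real.exp (-1)) :
    hardyC N / s + 1 / (s * Real.log s ^ 2) - 4 * Real.exp 1 ≤ radialPot N 0 s := by
  set y := Real.exp 1 * s with hy
  have hy0 : 0 < y := by positivity
  set l := -Real.log s with hl
  have hl1 : 1 < l := by
    have := (Real.log_lt_iff_lt_exp hs).2 hs1
    linarith
  set m := Real.log (1 + y) with hm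
  have hm0 : 0 ≤ m := Real.log_nonneg (by linarith)
  have hmy : m ≤ y := by
    have := Real.log_le_sub_one_of_pos (show 0 < 1 + y by linarith)
    linarith
  have ha : logWeight s = (l + m)⁻¹ := by
    rw [logWeight, show Real.exp 1 + s⁻¹ = (1 + y) / s by rw [hy]; field_simp; ring,
      Real.log_div (by positivity) hs.ne']
    congr 1
    ring
  have ha2 : 1 / l ^ 2 - 2 * y ≤ logWeight s ^ 2 := by
    rw [ha, inv_pow]
    have hlm : 0 < l + m := by linarith
    have : 1 / l ^ 2 - ((l + m) ^ 2)⁻¹ = m * (2 * l + m) / (l ^ 2 * (l + m) ^ 2) := by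
      field_simp
      ring
    have h2 : m * (2 * l + m) / (l ^ 2 * (l + m) ^ 2) ≤ 2 * m := by
      rw [div_le_iff₀ (by positivity)]
      have h3 : 2 * l + m ≤ 2 * (l + m) ^ 2 := by nlinarith
      have h4 : 1 ≤ l ^ 2 := by nlinarith
      calc m * (2 * l + m) ≤ m * (2 * (l + m) ^ 2) := by gcongr
        _ = 2 * m * (1 * (l + m) ^ 2) := by ring
        _ ≤ 2 * m * (l ^ 2 * (l + m) ^ 2) := by gcongr
    linarith
  have hh : 1 - 2 * y ≤ 2 / (1 + y) - 1 := by
    rw [le_sub_iff_add_le, le_div_iff₀ (by linarith)]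
    nlinarith
  have h1 := logWeight_pos hs
  have h2 := logWeight_le_one hs
  have key : 1 / l ^ 2 - 4 * y ≤ logWeight s ^ 2 * (2 / (1 + y) - 1) := by
    have := mul_le_mul_of_nonneg_left hh (sq_nonneg (logWeight s))
    have h3 : logWeight s ^ 2 ≤ 1 := pow_le_one₀ h1.le h2
    nlinarith [mul_le_mul_of_nonneg_right h3 hy0.le]
  rw [radialPot, add_zero, mul_zero, zero_add, sq (s : ℝ), mul_div_mul_left _ _ hs.ne', ← hy,
    le_div_iff₀ hs]
  have : (hardyC N / s + 1 / (s * Real.log s ^ 2) - 4 * Real.exp 1) * s =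
      hardyC N + (1 / l ^ 2 - 4 * y) := by
    have : Real.log s = -l := by rw [hl]; ring
    rw [this, hy]
    field_simp
    ring
  linarith

theorem tendsto_radialPot (N : ℕ) {s : ℝ} (hs : 0 < s) {δ : ℕ → ℝ}
    (hδ : Tendsto δ atTop (𝓝 0)) :
    Tendsto (fun n => radialPot N (δ n) s) atTop (𝓝 (radialPot N 0 s)) := by
  have hc : ContinuousAt (fun δ => logWeight (s + δ)) 0 :=
    ContinuousAt.comp (g := logWeight) (by
      rw [add_zero]; exact (hasDerivAt_logWeight hs).continuousAt) (by fun_prop)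
  have : ContinuousAt (fun δ => radialPot N δ s) 0 := by
    unfold radialPot
    refine ContinuousAt.div (by
      refine (((continuousAt_const.add hc).const_mul _).mul continuousAt_id).add
        (continuousAt_const.mul (continuousAt_const.add ((hc.pow 2).mul
          ((continuousAt_const.div (by fun_prop) ?_).sub continuousAt_const))))
      positivity) (by fun_prop) ?_
    positivity
  exact this.tendsto.comp hδ

variable {N : ℕ}

/-- The regularised Hardy vector field. -/
def radialField (N : ℕ) (δ : ℝ) (i : Fin N) (x : Sp N) : ℝ :=
  (((N : ℝ) - 2) / 2 + logWeight (‖x‖ ^ 2 + δ)) / (‖x‖ ^ 2 + δ) * x i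

theorem contDiff_radialField_coeff {δ : ℝ} (hδ : 0 < δ) : ContDiff ℝ ∞ fun x : Sp N =>
    (((N : ℝ) - 2) / 2 + logWeight (‖x‖ ^ 2 + δ)) / (‖x‖ ^ 2 + δ) := by
  have h1 : ContDiff ℝ ∞ fun x : Sp N => ‖x‖ ^ 2 + δ := (contDiff_norm_sq ℝ).add contDiff_const
  refine ContDiff.div (contDiff_const.add (contDiff_iff_contDiffAt.2 fun x => ?_)) h1
    fun x => by positivity
  exact (contDiffAt_logWeight (by positivity)).comp x h1.contDiffAt

theorem contDiff_radialField {δ : ℝ} (hδ : 0 < δ) (i : Fin N) :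
    ContDiff ℝ ∞ (radialField N δ i) :=
  (contDiff_radialField_coeff hδ).mul (contDiff_coord i)

theorem radialField_pot {δ : ℝ} (hδ : 0 < δ) (x : Sp N) :
    ∑ i, partialD i (radialField N δ i) x - ∑ i, radialField N δ i x ^ 2 =
      radialPot N δ (‖x‖ ^ 2) := by
  set s := ‖x‖ ^ 2 with hs
  have ht : 0 < s + δ := by positivity
  have hb : HasDerivAt (fun s => (((N : ℝ) - 2) / 2 + logWeight (s + δ)) / (s + δ)) _ s :=
    (((hasDerivAt_logWeight ht).comp_add_const s δ).const_add _).div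
      ((hasDerivAt_id s).add_const δ) ht.ne'
  have h := sum_partialD_radial_mul_coord (N := N)
    ((contDiff_radialField_coeff hδ).differentiable (by simp)) hb
  have h2 : ∑ i, radialField N δ i x ^ 2 =
      ((((N : ℝ) - 2) / 2 + logWeight (s + δ)) / (s + δ)) ^ 2 * s := by
    simp only [radialField, mul_pow, ← Finset.mul_sum, sum_coord_sq, ← hs]
  rw [h2]
  unfold radialField
  rw [h, ← hs, radialPot, hardyC]
  have : 0 < 1 + Real.exp 1 * (s + δ) := by positivity
  field_simp
  ring

end Radial

/-! ### The weighted Hardy inequality -/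

section Hardy

variable {N : ℕ} {μ : Sp N → ℝ}

theorem exists_weightedHardy (hN : 5 ≤ N) (hμ : IsProbDensity μ) (h2 : HypH2 μ) :
    ∃ C₁ : ℝ, 0 < C₁ ∧ WeightedHardy μ C₁ := by
  have : NeZero N := ⟨by omega⟩
  have : Nonempty (Fin N) := ⟨⟨0, by omega⟩⟩
  obtain ⟨R₀, hR₀, hnear⟩ := h2.near_zero
  -- For `|x| < R` the bound on `U` applies, `|x|² < e⁻¹`, and `log |x| ≠ 0`.
  set R := min R₀ (Real.exp (-1)) with hR
  have hRpos : 0 < R := lt_min hR₀ (Real.exp_pos _)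
  obtain ⟨M, hfar⟩ := h2.away_zero R hRpos
  obtain ⟨g, hg⟩ := h2.laplacian_mem
  have hzero := weakLaplacian_nonneg_of_eq_zero hμ.integrable hμ.nonneg hg.weakLaplacian
  -- `4 e` is the error of the logarithmic expansion inside `B_R`. Outside, the potential falls
  -- below `C₀/|x|²` by at most `1/|x|² ≤ 1/R²`, and `U ≤ M`.
  set C₁ := 4 * Real.exp 1 + 1 / R ^ 2 + |M| with hC₁
  have hC₁pos : 0 < C₁ := by positivity
  have hpot : ∀ᵐ x : Sp N, 0 < μ x →
      potU μ x ≤ radialPot N 0 (‖x‖ ^ 2) - hardyC N / ‖x‖ ^ 2 + C₁ := by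
    filter_upwards [hnear, hfar, Measure.ae_ne volume (0 : Sp N)] with x h1 h3 hx0 hμx
    have hs : 0 < ‖x‖ ^ 2 := by positivity
    rcases lt_or_ge ‖x‖ R with hlt | hge
    · have hx1 := hlt.trans_le (min_le_left _ _)
      have hx2 := hlt.trans_le (min_le_right _ _)
      have he : Real.exp (-1) ≤ 1 := Real.exp_le_one_iff.2 (by norm_num)
      have h5 := radialPot_zero_ge_log (N := N) hs (by nlinarith [norm_nonneg x])
      have h4 := h1 hμx hx1
      rw [sq_abs] at h4
      -- The factor `1/4` is absorbed by `log |x|² = 2 log |x|`.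
      have h6 : (1 / 4) * (1 / Real.log ‖x‖ ^ 2) =
          ‖x‖ ^ 2 * (1 / (‖x‖ ^ 2 * Real.log (‖x‖ ^ 2) ^ 2)) := by
        rw [Real.log_pow]
        have : Real.log ‖x‖ ≠ 0 := (Real.log_neg (norm_pos_iff.2 hx0) (by linarith)).ne
        push_cast
        field_simp
        norm_num
      rw [h6] at h4
      have h7 := le_of_mul_le_mul_left h4 hs
      have : 0 ≤ 1 / R ^ 2 + |M| := by positivity
      linarith
    · have h5 := radialPot_zero_ge (N := N) hs
      have h4 := h3 hμx hge
      rw [sub_div] at h5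
      have h6 : 1 / ‖x‖ ^ 2 ≤ 1 / R ^ 2 := by gcongr
      have := le_abs_self M
      have := Real.exp_pos 1
      linarith
  refine ⟨C₁, hC₁pos, fun φ hφ => ?_⟩
  have hq := hφ.norm_sq
  set W : Sp N → ℝ := fun x => ‖φ x‖ ^ 2 *
        ((1 / 4) * ∑ i, μ x * drift μ i x ^ 2 - (1 / 2) * weakLaplacian μ x) with hW
  set δ : ℕ → ℝ := fun n => 1 / ((n : ℝ) + 1) with hδ
  have hδ0 : ∀ n, 0 < δ n := fun n => by positivity
  have hle := fun n => integral_vectorField_le hμ h2 hφ fun i => contDiff_radialField (hδ0 n) i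
  have hWi : Integrable W := (hle 0).1
  obtain ⟨gi, gle⟩ := integrable_and_integral_le_of_tendsto (ν := volume)
    (f := fun n x => (radialPot N (δ n) (‖x‖ ^ 2) * ‖φ x‖ ^ 2) * μ x)
    (g := fun x => (radialPot N 0 (‖x‖ ^ 2) * ‖φ x‖ ^ 2) * μ x)
    (c := fun _ => (∫ x, (∑ i, ‖partialD i φ x‖ ^ 2) * μ x) + ∫ x, W x)
    (fun n => by
      simp only [← radialField_pot (hδ0 n)]
      exact integrable_test_mul_density hμ (hq.mul_left
        ((ContDiff.sum fun i _ => contDiff_partialD (contDiff_radialField (hδ0 n) i) i).sub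
        (ContDiff.sum fun i _ => (contDiff_radialField (hδ0 n) i).pow 2))))
    (fun n => by
      filter_upwards [hμ.nonneg] with x hx
      exact mul_nonneg (mul_nonneg (radialPot_nonneg hN (hδ0 n) (by positivity)) (by positivity)) hx)
    (by
      filter_upwards [Measure.ae_ne volume (0 : Sp N)] with x hx
      exact ((tendsto_radialPot N (by positivity) tendsto_one_div_add_atTop_nhds_zero_nat).mul_const
        _).mul_const _)
    (fun n => by
      have := (hle n).2
      simpa only [radialField_pot (hδ0 n)] using this)
    tendsto_const_nhds
  have hC := hardyC_ge hN
  -- The limiting potential dominates `(C₀ - 1)/|x|²` with `C₀ > 1`, so its integrability transfers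
  -- to the Hardy term.
  have qs : Integrable fun x => ‖φ x‖ ^ 2 / ‖x‖ ^ 2 * μ x := by
    refine (gi.div_const (hardyC N - 1)).mono' ?_ ?_
    · exact (hq.continuous.measurable.div (measurable_norm.pow_const 2)).aestronglyMeasurable.mul
        hμ.integrable.1
    · filter_upwards [Measure.ae_ne volume (0 : Sp N), hμ.nonneg] with x hx hx0
      have h := radialPot_zero_ge (N := N) (s := ‖x‖ ^ 2) (by positivity)
      rw [Real.norm_of_nonneg (by positivity), le_div_iff₀ (by linarith)]
      calc ‖φ x‖ ^ 2 / ‖x‖ ^ 2 * μ x * (hardyC N - 1)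
          = (hardyC N - 1) / ‖x‖ ^ 2 * ‖φ x‖ ^ 2 * μ x := by ring
        _ ≤ _ := by gcongr
  have qm := integrable_test_mul_density hμ hq
  have hWle : ∫ x, W x ≤ (∫ x, (radialPot N 0 (‖x‖ ^ 2) * ‖φ x‖ ^ 2) * μ x)
      - hardyC N * (∫ x, ‖φ x‖ ^ 2 / ‖x‖ ^ 2 * μ x) + C₁ * ∫ x, ‖φ x‖ ^ 2 * μ x := by
    have j : Integrable fun x => (radialPot N 0 (‖x‖ ^ 2) * ‖φ x‖ ^ 2) * μ x -
      hardyC N * (‖φ x‖ ^ 2 / ‖x‖ ^ 2 * μ x) := gi.sub (qs.const_mul _)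
    rw [← integral_const_mul, ← integral_const_mul, ← integral_sub gi (qs.const_mul _),
      ← integral_add j (qm.const_mul _)]
    refine integral_mono_ae hWi (j.add (qm.const_mul _)) ?_
    filter_upwards [hpot, hzero, hμ.nonneg] with x h1 h3 h0
    -- On `{μ = 0}` only `-½ |φ|² Δμ ≤ 0` survives; on `{μ > 0}` the bound on `U` applies.
    rcases h0.eq_or_lt with he | hlt
    · have := h3 he.symm
      simp only [hW, ← he, zero_mul, mul_zero, Finset.sum_const_zero]
      nlinarith [sq_nonneg ‖φ x‖]
    · have e : W x = potU μ x * (‖φ x‖ ^ 2 * μ x) := by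
        simp only [hW, potU, ← Finset.mul_sum]
        field_simp
      rw [e]
      have := mul_le_mul_of_nonneg_right (h1 hlt) (mul_nonneg (sq_nonneg ‖φ x‖) h0)
      refine this.trans (le_of_eq ?_)
      ring
  constructor
  · rw [integrable_wMeasure_iff hμ]
    simpa only [smul_eq_mul, mul_comm] using qs
  · simp only [integral_wMeasure hμ, smul_eq_mul, mul_comm (μ _)]
    linarith

end Hardy

theorem integral_inner_le_sqrt_mul_sqrt {α E : Type*} [MeasurableSpace α] {ν : Measure α}
    [NormedAddCommGroup E] [InnerProductSpace ℝ E] {f g : α → E}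
    (hf : MemLp f 2 ν) (hg : MemLp g 2 ν) :
    ∫ x, inner ℝ (f x) (g x) ∂ν ≤ √(∫ x, ‖f x‖ ^ 2 ∂ν) * √(∫ x, ‖g x‖ ^ 2 ∂ν) := by
  have key : ∀ {f g : α → E} (hf : MemLp f 2 ν) (hg : MemLp g 2 ν),
      inner ℝ (hf.toLp f) (hg.toLp g) = ∫ x, inner ℝ (f x) (g x) ∂ν := fun hf hg => by
    rw [L2.inner_def]
    refine integral_congr_ae ?_
    filter_upwards [hf.coeFn_toLp, hg.coeFn_toLp] with x h1 h2
    rw [h1, h2]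
  have hn : ∀ {f : α → E} (hf : MemLp f 2 ν), √(∫ x, ‖f x‖ ^ 2 ∂ν) = ‖hf.toLp f‖ := fun hf => by
    rw [← Real.sqrt_sq (norm_nonneg (hf.toLp _)), ← real_inner_self_eq_norm_sq, key hf hf]
    simp only [real_inner_self_eq_norm_sq]
  rw [← key hf hg, hn hf, hn hg]
  exact real_inner_le_norm _ _

/-! ### The operator `L` on test functions -/

section Kolmogorov

variable {N : ℕ} {μ : Sp N → ℝ}

theorem IsTest.memLp_wMeasure (hμ : IsProbDensity μ) {u : Sp N → ℂ} (hu : IsTest u) :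
    MemLp u 2 (wMeasure μ) := by
  have := isFiniteMeasure_wMeasure hμ
  exact hu.continuous.memLp_of_hasCompactSupport hu.2

theorem IsTest.laplacian {u : Sp N → ℂ} (hu : IsTest u) : IsTest (Laplacian.laplacian u) := by
  rw [funext (laplacian_eq_sum hu.1)]
  refine ⟨ContDiff.sum fun i _ => ((hu.partialD i).partialD i).1, hu.2.mono' fun x hx => ?_⟩
  contrapose! hx
  rw [Function.mem_support, not_not]
  refine Finset.sum_eq_zero fun i _ => image_eq_zero_of_notMem_tsupport fun h => hx ?_
  exact tsupport_fderiv_apply_subset ℝ (stdVec i)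
    (tsupport_fderiv_apply_subset ℝ (stdVec i) h)

theorem memLp_drift_smul (hμ : IsProbDensity μ) (h2 : HypH2 μ) {u : Sp N → ℂ} (hu : IsTest u)
    (i : Fin N) : MemLp (fun x => drift μ i x • u x) 2 (wMeasure μ) := by
  rw [memLp_two_iff_integrable_sq_norm, integrable_wMeasure_iff hμ]
  · refine (integrable_test_mul_drift_sq hμ h2 hu.norm_sq i).congr (Eventually.of_forall fun x => ?_)
    simp only [norm_smul, mul_pow, Real.norm_eq_abs, sq_abs, smul_eq_mul]
    ring
  · exact ((aestronglyMeasurable_drift hμ h2 i).mono_ac wMeasure_absolutelyContinuous).smul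
      hu.continuous.aestronglyMeasurable

theorem memLp_kolmogorov (hμ : IsProbDensity μ) (h2 : HypH2 μ) {u : Sp N → ℂ} (hu : IsTest u) :
    MemLp (kolmogorov μ u) 2 (wMeasure μ) :=
  (hu.laplacian.memLp_wMeasure hμ).add
    (memLp_finsetSum _ fun i _ => memLp_drift_smul hμ h2 (hu.partialD i) i)

theorem kolmogorov_sub {u v : Sp N → ℂ} (hu : IsTest u) (hv : IsTest v) (x : Sp N) :
    kolmogorov μ (fun y => u y - v y) x = kolmogorov μ u x - kolmogorov μ v x := by
  have h : ∀ i, partialD i (fun y => u y - v y) = fun y => partialD i u y - partialD i v y :=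
    fun i => funext fun y => partialD_sub hu.differentiable hv.differentiable i y
  simp only [kolmogorov, laplacian_eq_sum hu.1, laplacian_eq_sum hv.1,
    laplacian_eq_sum (hu.sub hv).1, h,
    partialD_sub (hu.partialD _).differentiable (hv.partialD _).differentiable, smul_sub,
    Finset.sum_sub_distrib]
  ring

/-- Integration by parts for `L` in `L²_μ`. -/
theorem integral_inner_kolmogorov (hμ : IsProbDensity μ) (h2 : HypH2 μ) {u v : Sp N → ℂ}
    (hu : IsTest u) (hv : IsTest v) :
    ∫ x, inner ℝ (v x) (kolmogorov μ u x) ∂(wMeasure μ) =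
      - ∫ x, ∑ i, inner ℝ (partialD i v x) (partialD i u x) ∂(wMeasure μ) := by
  have hψ := fun i => hv.inner (hu.partialD i).1
  have hA := fun i => hv.inner ((hu.partialD i).partialD i).1
  have hB := fun i => (hv.partialD i).inner (hu.partialD i).1
  have iA := fun i => integrable_test_mul_density hμ (hA i)
  have iB := fun i => integrable_test_mul_density hμ (hB i)
  have iC := fun i => integrable_test_mul_drift hμ h2 (hψ i) i
  have e := fun i => integral_partialD_mul_density hμ h2 (hψ i) i
  simp only [partialD_inner hv.differentiable (hu.partialD _).differentiable, add_mul] at e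
  have e' : ∀ i, (∫ x, inner ℝ (v x) (partialD i (partialD i u) x) * μ x) +
      (∫ x, inner ℝ (v x) (partialD i u x) * (μ x * drift μ i x)) =
      - ∫ x, inner ℝ (partialD i v x) (partialD i u x) * μ x := fun i => by
    have := e i
    rw [integral_add (iA i) (iB i)] at this
    linarith
  rw [integral_wMeasure hμ, integral_wMeasure hμ]
  have l : ∀ x, μ x • inner ℝ (v x) (kolmogorov μ u x) =
      ∑ i, (inner ℝ (v x) (partialD i (partialD i u) x) * μ x +
        inner ℝ (v x) (partialD i u x) * (μ x * drift μ i x)) := fun x => by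
    rw [kolmogorov, laplacian_eq_sum hu.1, inner_add_right, inner_sum, inner_sum,
      ← Finset.sum_add_distrib, smul_eq_mul, Finset.mul_sum]
    refine Finset.sum_congr rfl fun i _ => ?_
    rw [inner_smul_right]
    ring
  have r : ∀ x, μ x • ∑ i, inner ℝ (partialD i v x) (partialD i u x) =
      ∑ i, inner ℝ (partialD i v x) (partialD i u x) * μ x := fun x => by
    rw [smul_eq_mul, mul_comm, Finset.sum_mul]
  simp only [l, r]
  have iAC : ∀ i, Integrable fun x => inner ℝ (v x) (partialD i (partialD i u) x) * μ x +
      inner ℝ (v x) (partialD i u x) * (μ x * drift μ i x) := fun i => (iA i).add (iC i)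
  rw [integral_finsetSum _ fun i _ => iAC i, integral_finsetSum _ fun i _ => iB i,
    ← Finset.sum_neg_distrib]
  refine Finset.sum_congr rfl fun i _ => ?_
  rw [← e' i, integral_add (iA i) (iC i)]

theorem integrable_sum_partialD_sq (hμ : IsProbDensity μ) {u : Sp N → ℂ} (hu : IsTest u) :
    Integrable (fun x => ∑ i, ‖partialD i u x‖ ^ 2) (wMeasure μ) :=
  integrable_finsetSum _ fun i _ => integrable_wMeasure_of_compact hμ
    (hu.partialD i).norm_sq.continuous (hu.partialD i).norm_sq.2

/-- Pair `Lu` with `-u` and use Cauchy–Schwarz. Applied to differences, this controls gradients in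
the graph norm of `L`. -/
theorem integral_grad_sq_le (hμ : IsProbDensity μ) (h2 : HypH2 μ) {u : Sp N → ℂ}
    (hu : IsTest u) :
    ∫ x, ∑ i, ‖partialD i u x‖ ^ 2 ∂(wMeasure μ) ≤
      √(∫ x, ‖u x‖ ^ 2 ∂(wMeasure μ)) * √(∫ x, ‖kolmogorov μ u x‖ ^ 2 ∂(wMeasure μ)) := by
  have h1 := integral_inner_kolmogorov hμ h2 hu hu
  simp only [real_inner_self_eq_norm_sq] at h1
  have h3 := integral_inner_le_sqrt_mul_sqrt (hu.memLp_wMeasure hμ).neg (memLp_kolmogorov hμ h2 hu)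
  simp only [Pi.neg_apply, inner_neg_left, norm_neg, integral_neg] at h3
  linarith

end Kolmogorov

/-! ### The Rellich inequalities on test functions -/

section Rellich

variable {N : ℕ} {μ : Sp N → ℝ}

theorem contDiff_rsqrt_norm_sq {δ : ℝ} (hδ : 0 < δ) :
    ContDiff ℝ ∞ fun x : Sp N => (√(‖x‖ ^ 2 + δ))⁻¹ := by
  have h1 : ContDiff ℝ ∞ fun x : Sp N => ‖x‖ ^ 2 + δ := (contDiff_norm_sq ℝ).add contDiff_const
  exact (h1.sqrt fun x => by positivity).inv fun x => by positivity

/-- This is `∇(r² u) · ∇u = |∇(r u)|² - |∇r|² |u|²` for real `r`, with `r = (|x|² + δ)^(-1/2)`. -/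
theorem sum_inner_partialD_eq {δ : ℝ} (hδ : 0 < δ) {u : Sp N → ℂ} (hu : IsTest u) (x : Sp N) :
    ∑ i, inner ℝ (partialD i (fun y => (√(‖y‖ ^ 2 + δ))⁻¹ • (√(‖y‖ ^ 2 + δ))⁻¹ • u y) x)
        (partialD i u x) =
      ∑ i, ‖partialD i (fun y => (√(‖y‖ ^ 2 + δ))⁻¹ • u y) x‖ ^ 2 -
        ‖x‖ ^ 2 / (‖x‖ ^ 2 + δ) ^ 3 * ‖u x‖ ^ 2 := by
  have hr := (contDiff_rsqrt_norm_sq (N := N) hδ).differentiable (by simp)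
  have hru := (hu.smul_left (contDiff_rsqrt_norm_sq hδ)).differentiable
  set s := ‖x‖ ^ 2 with hs
  have ht : 0 < s + δ := by positivity
  have hb : HasDerivAt (fun s => (√(s + δ))⁻¹) _ s :=
    (((hasDerivAt_id s).add_const δ).sqrt ht.ne').inv (by positivity)
  have hsum : ∑ i, partialD i (fun y : Sp N => (√(‖y‖ ^ 2 + δ))⁻¹) x ^ 2 = s / (s + δ) ^ 3 := by
    simp only [partialD_radial hb, mul_pow, ← Finset.mul_sum, sum_coord_sq, ← hs]
    have h2 : √(s + δ) ^ 2 = s + δ := Real.sq_sqrt ht.le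
    simp only [id, div_pow, neg_sq, mul_pow, h2]
    field_simp
  rw [← hsum, Finset.sum_mul, ← Finset.sum_sub_distrib]
  refine Finset.sum_congr rfl fun i _ => ?_
  rw [partialD_smul hr hru, partialD_smul hr hu.differentiable, ← hs, norm_add_sq_real]
  simp only [inner_add_left, inner_smul_left, inner_smul_right, smul_add, norm_smul, mul_pow,
    Real.norm_eq_abs, sq_abs, real_inner_self_eq_norm_sq]
  simp
  ring

/-- Pair `Lu` with `-r² u`, where `r = (|x|² + δ)^(-1/2)`, and use Hardy for `r u`. The term `|∇r|²
|u|² ≤ r⁴ |u|²` is what lowers `C₀` to `C₀ - 1`. -/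
theorem rellich_regularised (hN : 5 ≤ N) (hμ : IsProbDensity μ) (h2 : HypH2 μ) {C₁ : ℝ}
    (hH : WeightedHardy μ C₁) {u : Sp N → ℂ} (hu : IsTest u) {δ : ℝ} (hδ : 0 < δ) :
    (hardyC N - 1) * (∫ x, ‖u x‖ ^ 2 / (‖x‖ ^ 2 + δ) ^ 2 ∂(wMeasure μ)) ≤
      √(∫ x, ‖u x‖ ^ 2 / (‖x‖ ^ 2 + δ) ^ 2 ∂(wMeasure μ)) *
        √(∫ x, ‖kolmogorov μ u x‖ ^ 2 ∂(wMeasure μ)) +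
      C₁ * ∫ x, ‖u x‖ ^ 2 / (‖x‖ ^ 2 + δ) ∂(wMeasure μ) := by
  have hr := contDiff_rsqrt_norm_sq (N := N) hδ
  have hφ := hu.smul_left hr
  have hv := hφ.smul_left hr
  have hC := hardyC_ge hN
  have ht : ∀ x : Sp N, 0 < ‖x‖ ^ 2 + δ := fun x => by positivity
  have nφ : ∀ x, ‖(√(‖x‖ ^ 2 + δ))⁻¹ • u x‖ ^ 2 = ‖u x‖ ^ 2 / (‖x‖ ^ 2 + δ) := fun x => by
    rw [norm_smul, mul_pow, Real.norm_eq_abs, sq_abs, inv_pow, Real.sq_sqrt (ht x).le]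
    field_simp
  have nv : ∀ x, ‖(√(‖x‖ ^ 2 + δ))⁻¹ • (√(‖x‖ ^ 2 + δ))⁻¹ • u x‖ ^ 2 =
      ‖u x‖ ^ 2 / (‖x‖ ^ 2 + δ) ^ 2 := fun x => by
    rw [norm_smul, mul_pow, nφ, Real.norm_eq_abs, sq_abs, inv_pow, Real.sq_sqrt (ht x).le]
    field_simp
  obtain ⟨hi, hh⟩ := hH _ hφ
  simp only [nφ] at hi hh
  have iA : Integrable (fun x => ‖u x‖ ^ 2 / (‖x‖ ^ 2 + δ) ^ 2) (wMeasure μ) := by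
    have := integrable_wMeasure_of_compact hμ hv.norm_sq.continuous hv.norm_sq.2
    simpa only [nv] using this
  have hibp := integral_inner_kolmogorov hμ h2 hu hv
  simp only [sum_inner_partialD_eq hδ hu] at hibp
  have iS : Integrable (fun x => ‖x‖ ^ 2 / (‖x‖ ^ 2 + δ) ^ 3 * ‖u x‖ ^ 2) (wMeasure μ) := by
    refine integrable_wMeasure_of_compact hμ ?_ hu.norm_sq.2.mul_left
    exact ((continuous_norm.pow 2).div (by fun_prop) fun x => by have := ht x; positivity).mul
      hu.norm_sq.continuous
  rw [integral_sub (integrable_sum_partialD_sq hμ hφ) iS] at hibp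
  have hcs := integral_inner_le_sqrt_mul_sqrt (hv.memLp_wMeasure hμ).neg
    (memLp_kolmogorov hμ h2 hu)
  simp only [Pi.neg_apply, inner_neg_left, norm_neg, integral_neg, nv] at hcs
  have hS : ∫ x, ‖x‖ ^ 2 / (‖x‖ ^ 2 + δ) ^ 3 * ‖u x‖ ^ 2 ∂(wMeasure μ) ≤
      ∫ x, ‖u x‖ ^ 2 / (‖x‖ ^ 2 + δ) ^ 2 ∂(wMeasure μ) := by
    refine integral_mono iS iA fun x => ?_
    have := ht x
    simp only
    rw [div_mul_eq_mul_div, div_le_div_iff₀ (by positivity) (by positivity)]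
    have : ‖x‖ ^ 2 ≤ ‖x‖ ^ 2 + δ := by linarith
    calc ‖x‖ ^ 2 * ‖u x‖ ^ 2 * (‖x‖ ^ 2 + δ) ^ 2
        ≤ (‖x‖ ^ 2 + δ) * ‖u x‖ ^ 2 * (‖x‖ ^ 2 + δ) ^ 2 := by gcongr
      _ = _ := by ring
  have hA : ∫ x, ‖u x‖ ^ 2 / (‖x‖ ^ 2 + δ) ^ 2 ∂(wMeasure μ) ≤
      ∫ x, ‖u x‖ ^ 2 / (‖x‖ ^ 2 + δ) / ‖x‖ ^ 2 ∂(wMeasure μ) := by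
    refine integral_mono_ae iA hi ?_
    filter_upwards [ae_wMeasure_ne_zero (μ := μ) (by omega : N ≠ 0)] with x hx
    have := ht x
    rw [div_div, sq (‖x‖ ^ 2 + δ)]
    have : 0 < ‖x‖ ^ 2 := by positivity
    gcongr
    linarith
  have := mul_le_mul_of_nonneg_left hA (by linarith : 0 ≤ hardyC N)
  linarith

/-- Dividing by `a > 0` gives `c a - C₁ n ≤ l`. If the left side is nonnegative, square it and split
`2 c a C₁ n ≤ ε a² + (c C₁ n)²/ε`. Otherwise `c a ≤ C₁ n`, and `c² - ε ≤ c⁴/ε` suffices. -/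
theorem rellich_eps_algebra {c a l n C₁ ε : ℝ} (hc : 0 < c) (ha : 0 ≤ a)
    (hε : 0 < ε) (h : c * a ^ 2 ≤ a * l + C₁ * (a * n)) :
    (c ^ 2 - ε) * a ^ 2 ≤ l ^ 2 + (c * C₁) ^ 2 / ε * n ^ 2 := by
  have e : l ^ 2 + (c * C₁) ^ 2 / ε * n ^ 2 = (ε * l ^ 2 + (c * C₁ * n) ^ 2) / ε := by
    field_simp
  rw [e, le_div_iff₀ hε]
  rcases ha.eq_or_lt with rfl | ha
  · nlinarith [mul_nonneg hε.le (sq_nonneg l), sq_nonneg (c * C₁ * n)]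
  · have h' : c * a ≤ l + C₁ * n := by nlinarith
    rcases le_total (C₁ * n) (c * a) with h1 | h1
    · have h3 : (c * a - C₁ * n) ^ 2 ≤ l ^ 2 := by
        apply pow_le_pow_left₀ <;> linarith
      have h4 := mul_le_mul_of_nonneg_left h3 hε.le
      nlinarith [sq_nonneg (ε * a - c * C₁ * n), mul_nonneg hε.le (sq_nonneg (C₁ * n))]
    · have h3 : (c * (c * a)) ^ 2 ≤ (c * (C₁ * n)) ^ 2 := by
        apply pow_le_pow_left₀ (by positivity)
        gcongr
      nlinarith [mul_nonneg hε.le (sq_nonneg l), mul_nonneg (sq_nonneg (c ^ 2 - ε)) (sq_nonneg a),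
        sq_nonneg (c * a), mul_nonneg hε.le (sq_nonneg (c * a))]

theorem rellich_of_test (hN : 5 ≤ N) (hμ : IsProbDensity μ) (h2 : HypH2 μ) {C₁ : ℝ}
    (hC₁ : 0 < C₁) (hH : WeightedHardy μ C₁) {u : Sp N → ℂ} (hu : IsTest u) :
    Integrable (fun x => ‖u x‖ ^ 2 / ‖x‖ ^ 4) (wMeasure μ) ∧
      RellichEps μ C₁ u (kolmogorov μ u) ∧
      RellichSharp μ C₁ u (kolmogorov μ u) (fun i => partialD i u) := by
  have hC := hardyC_ge hN
  have hc : 0 < hardyC N - 1 := by linarith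
  set δ : ℕ → ℝ := fun n => 1 / ((n : ℝ) + 1) with hδ
  have hδ0 : ∀ n, 0 < δ n := fun n => by positivity
  have hq := hu.norm_sq
  have hcont : ∀ n, Continuous fun x : Sp N => ‖x‖ ^ 2 + δ n := fun n => by fun_prop
  have hpos : ∀ n (x : Sp N), 0 < ‖x‖ ^ 2 + δ n := fun n x => by have := hδ0 n; positivity
  have iA : ∀ n, Integrable (fun x => ‖u x‖ ^ 2 / (‖x‖ ^ 2 + δ n) ^ 2) (wMeasure μ) := fun n =>
    integrable_wMeasure_of_compact hμ
      (hq.continuous.div ((hcont n).pow 2) fun x => (pow_pos (hpos n x) 2).ne')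
      (by simp only [div_eq_mul_inv]; exact hq.2.mul_right)
  have iB : ∀ n, Integrable (fun x => ‖u x‖ ^ 2 / (‖x‖ ^ 2 + δ n)) (wMeasure μ) := fun n =>
    integrable_wMeasure_of_compact hμ
      (hq.continuous.div (hcont n) fun x => (hpos n x).ne')
      (by simp only [div_eq_mul_inv]; exact hq.2.mul_right)
  have fatou : ∀ {κ C : ℝ}, 0 < κ →
      (∀ n, κ * (∫ x, ‖u x‖ ^ 2 / (‖x‖ ^ 2 + δ n) ^ 2 ∂(wMeasure μ)) ≤ C) →
      Integrable (fun x => ‖u x‖ ^ 2 / ‖x‖ ^ 4) (wMeasure μ) ∧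
        κ * (∫ x, ‖u x‖ ^ 2 / ‖x‖ ^ 4 ∂(wMeasure μ)) ≤ C := by
    intro κ C hκ h
    have := integrable_and_integral_le_of_tendsto (ν := wMeasure μ) (C := C / κ) (c := fun _ => C / κ)
      (g := fun x => ‖u x‖ ^ 2 / ‖x‖ ^ 4) iA
      (fun n => Eventually.of_forall fun x => by have := hpos n x; positivity)
      (by
        filter_upwards [ae_wMeasure_ne_zero (μ := μ) (by omega : N ≠ 0)] with x hx
        have h0 : Tendsto (fun n => (‖x‖ ^ 2 + δ n) ^ 2) atTop (𝓝 (‖x‖ ^ 4)) := by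
          have := (tendsto_one_div_add_atTop_nhds_zero_nat (𝕜 := ℝ)).const_add (‖x‖ ^ 2) |>.pow 2
          convert! this using 2
          ring
        exact tendsto_const_nhds.div h0 (by positivity))
      (fun n => by rw [le_div_iff₀ hκ, mul_comm]; exact h n) tendsto_const_nhds
    refine ⟨this.1, ?_⟩
    rw [mul_comm, ← le_div_iff₀ hκ]
    exact this.2
  set l := √(∫ x, ‖kolmogorov μ u x‖ ^ 2 ∂(wMeasure μ)) with hl
  have hl2 : l ^ 2 = ∫ x, ‖kolmogorov μ u x‖ ^ 2 ∂(wMeasure μ) :=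
    Real.sq_sqrt (integral_nonneg fun x => by positivity)
  set m := √(∫ x, ‖u x‖ ^ 2 ∂(wMeasure μ)) with hm
  have hm2 : m ^ 2 = ∫ x, ‖u x‖ ^ 2 ∂(wMeasure μ) :=
    Real.sq_sqrt (integral_nonneg fun x => by positivity)
  have hreg := fun n => rellich_regularised hN hμ h2 hH hu (hδ0 n)
  have hA0 : ∀ n, 0 ≤ ∫ x, ‖u x‖ ^ 2 / (‖x‖ ^ 2 + δ n) ^ 2 ∂(wMeasure μ) := fun n =>
    integral_nonneg fun x => by have := hpos n x; positivity
  -- Cauchy–Schwarz bound on the lower-order term, used for the `ε`-version.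
  have hB1 : ∀ n, ∫ x, ‖u x‖ ^ 2 / (‖x‖ ^ 2 + δ n) ∂(wMeasure μ) ≤
      √(∫ x, ‖u x‖ ^ 2 / (‖x‖ ^ 2 + δ n) ^ 2 ∂(wMeasure μ)) * m := fun n => by
    have hw : IsTest fun x => (‖x‖ ^ 2 + δ n)⁻¹ • u x := hu.smul_left
      (((contDiff_norm_sq ℝ).add contDiff_const).inv fun x => (hpos n x).ne')
    have := integral_inner_le_sqrt_mul_sqrt (hw.memLp_wMeasure hμ) (hu.memLp_wMeasure hμ)
    have e1 : ∀ x, inner ℝ ((‖x‖ ^ 2 + δ n)⁻¹ • u x) (u x) = ‖u x‖ ^ 2 / (‖x‖ ^ 2 + δ n) :=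
      fun x => by
        rw [real_inner_smul_left, real_inner_self_eq_norm_sq, div_eq_inv_mul]
    have e2 : ∀ x, ‖(‖x‖ ^ 2 + δ n)⁻¹ • u x‖ ^ 2 = ‖u x‖ ^ 2 / (‖x‖ ^ 2 + δ n) ^ 2 := fun x => by
      rw [norm_smul, mul_pow, Real.norm_eq_abs, sq_abs, inv_pow, div_eq_inv_mul]
    simpa only [e1, e2] using this
  obtain ⟨hi, hh⟩ := hH u hu
  -- Comparison with the Hardy integral of `u` itself, used for the sharp version.
  have hB2 : ∀ n, ∫ x, ‖u x‖ ^ 2 / (‖x‖ ^ 2 + δ n) ∂(wMeasure μ) ≤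
      ∫ x, ‖u x‖ ^ 2 / ‖x‖ ^ 2 ∂(wMeasure μ) := fun n => by
    refine integral_mono_ae (iB n) hi ?_
    filter_upwards [ae_wMeasure_ne_zero (μ := μ) (by omega : N ≠ 0)] with x hx
    have : 0 < ‖x‖ ^ 2 := by positivity
    have := hδ0 n
    gcongr
    linarith
  have sharp : ∀ n, (hardyC N - 1) ^ 2 *
      (∫ x, ‖u x‖ ^ 2 / (‖x‖ ^ 2 + δ n) ^ 2 ∂(wMeasure μ)) ≤
      ∫ x, ‖kolmogorov μ u x‖ ^ 2 ∂(wMeasure μ) +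
      2 * (hardyC N - 1) * C₁ / hardyC N * ∫ x, ∑ i, ‖partialD i u x‖ ^ 2 ∂(wMeasure μ) +
      2 * (hardyC N - 1) * C₁ ^ 2 / hardyC N * ∫ x, ‖u x‖ ^ 2 ∂(wMeasure μ) := fun n => by
    have h1 := hreg n
    rw [← hl] at h1
    set A := ∫ x, ‖u x‖ ^ 2 / (‖x‖ ^ 2 + δ n) ^ 2 ∂(wMeasure μ) with hAdef
    set B := ∫ x, ‖u x‖ ^ 2 / (‖x‖ ^ 2 + δ n) ∂(wMeasure μ)
    set D := ∫ x, ∑ i, ‖partialD i u x‖ ^ 2 ∂(wMeasure μ)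
    set Q := ∫ x, ‖u x‖ ^ 2 ∂(wMeasure μ)
    set H := ∫ x, ‖u x‖ ^ 2 / ‖x‖ ^ 2 ∂(wMeasure μ)
    have hs : √A ^ 2 = A := Real.sq_sqrt (hA0 n)
    -- Multiply `h1` by `c = C₀ - 1` and absorb `c √A l ≤ (c² A + l²)/2`.
    have h3 : (hardyC N - 1) ^ 2 * A ≤ l ^ 2 + 2 * (hardyC N - 1) * C₁ * B := by
      nlinarith [sq_nonneg ((hardyC N - 1) * √A - l), mul_le_mul_of_nonneg_left h1 hc.le]
    have h4 : B ≤ (D + C₁ * Q) / hardyC N := by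
      rw [le_div_iff₀ (by linarith)]
      have := mul_le_mul_of_nonneg_right (hB2 n) (by linarith : 0 ≤ hardyC N)
      linarith
    have h5 := mul_le_mul_of_nonneg_left h4 (by positivity : 0 ≤ 2 * (hardyC N - 1) * C₁)
    rw [← hl2]
    have e : 2 * (hardyC N - 1) * C₁ * ((D + C₁ * Q) / hardyC N) =
      2 * (hardyC N - 1) * C₁ / hardyC N * D + 2 * (hardyC N - 1) * C₁ ^ 2 / hardyC N * Q := by
      ring
    linarith
  obtain ⟨f1, f2⟩ := fatou (by positivity : 0 < (hardyC N - 1) ^ 2) sharp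
  refine ⟨f1, fun ε hε => ?_, f2⟩
  -- Fatou requires a positive coefficient; for a nonpositive one the inequality is trivial by sign.
  rcases le_or_gt ((hardyC N - 1) ^ 2 - ε) 0 with hneg | hκ
  · have h1 : 0 ≤ ∫ x, ‖u x‖ ^ 2 / ‖x‖ ^ 4 ∂(wMeasure μ) :=
      integral_nonneg fun x => by positivity
    rw [← hl2, ← hm2]
    have h3 : 0 ≤ l ^ 2 + ((hardyC N - 1) * C₁) ^ 2 / ε * m ^ 2 := by positivity
    nlinarith
  · refine (fatou hκ fun n => ?_).2
    rw [← hl2, ← hm2]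
    have h1 := hreg n
    have hs := Real.sq_sqrt (hA0 n)
    have h3 := mul_le_mul_of_nonneg_left (hB1 n) hC₁.le
    rw [← hs]
    refine rellich_eps_algebra hc (Real.sqrt_nonneg _) hε ?_
    rw [hs]
    linarith

end Rellich

/-! ### Passage to the closure of `L` -/

section Closure

variable {N : ℕ} {μ : Sp N → ℝ}

theorem norm_toLp_sq {α E : Type*} [MeasurableSpace α] {ν : Measure α}
    [NormedAddCommGroup E] [InnerProductSpace ℝ E] {f : α → E} (hf : MemLp f 2 ν) :
    ‖hf.toLp f‖ ^ 2 = ∫ x, ‖f x‖ ^ 2 ∂ν := by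
  rw [← real_inner_self_eq_norm_sq, L2.inner_def]
  refine integral_congr_ae ?_
  filter_upwards [hf.coeFn_toLp] with x h1
  rw [h1, real_inner_self_eq_norm_sq]

/-- The lower bound `μ ≥ c > 0` on `K` allows `C = 1/c`. Through this, `L²_μ` convergence becomes
Lebesgue convergence on compact sets. -/
theorem exists_restrict_le_smul_wMeasure (h1 : HypH1 μ) {K : Set (Sp N)} (hK : IsCompact K) :
    ∃ C : ℝ≥0∞, C ≠ ⊤ ∧ volume.restrict K ≤ C • wMeasure μ := by
  obtain ⟨c, hc, hcμ⟩ := h1.pos K hK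
  have hle : ENNReal.ofReal c • volume.restrict K ≤ wMeasure μ := by
    rw [← withDensity_const]
    calc (volume.restrict K).withDensity (fun _ => ENNReal.ofReal c)
        ≤ (volume.restrict K).withDensity fun x => ENNReal.ofReal (μ x) :=
          withDensity_mono ((ae_restrict_iff' hK.measurableSet).2 (by
            filter_upwards [hcμ] with x hx hxK
            exact ENNReal.ofReal_le_ofReal (hx hxK)))
      _ = (wMeasure μ).restrict K := (restrict_withDensity hK.measurableSet _).symm
      _ ≤ wMeasure μ := Measure.restrict_le_self
  have hc0 : ENNReal.ofReal c ≠ 0 := by simpa using hc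
  refine ⟨(ENNReal.ofReal c)⁻¹, ENNReal.inv_ne_top.2 hc0, ?_⟩
  calc volume.restrict K = (ENNReal.ofReal c)⁻¹ • ENNReal.ofReal c • volume.restrict K := by
        rw [smul_smul, ENNReal.inv_mul_cancel hc0 ENNReal.ofReal_ne_top, one_smul]
    _ ≤ _ := by gcongr

theorem locMemLp_of_memLp_wMeasure (h1 : HypH1 μ) {f : Sp N → ℂ} (hf : MemLp f 2 (wMeasure μ)) :
    LocMemLp f 2 := fun _ hK => by
  obtain ⟨C, hC, hle⟩ := exists_restrict_le_smul_wMeasure h1 hK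
  exact (hf.smul_measure hC).mono_measure hle

theorem locallyIntegrable_of_memLp_wMeasure (h1 : HypH1 μ) {f : Sp N → ℂ}
    (hf : MemLp f 2 (wMeasure μ)) : LocallyIntegrable f :=
  locallyIntegrable_iff.2 fun K hK => by
    have : IsFiniteMeasure (volume.restrict K) := ⟨by simpa using hK.measure_lt_top⟩
    exact (locMemLp_of_memLp_wMeasure h1 hf K hK).integrable (by norm_num)

/-- On the support of `ψ`, the Lebesgue `L¹` norm is bounded by the `L²` norm, hence by a constant
times the `L²_μ` norm. -/
theorem tendsto_integral_smul_of_eLpNorm (h1 : HypH1 μ) {h : ℕ → Sp N → ℂ} {f : Sp N → ℂ}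
    (hh : ∀ n, MemLp (h n) 2 (wMeasure μ)) (hf : MemLp f 2 (wMeasure μ))
    (hlim : Tendsto (fun n => eLpNorm (fun x => h n x - f x) 2 (wMeasure μ)) atTop (𝓝 0))
    {ψ : Sp N → ℝ} (hψ : Continuous ψ) (hs : HasCompactSupport ψ) :
    Tendsto (fun n => ∫ x, ψ x • h n x) atTop (𝓝 (∫ x, ψ x • f x)) := by
  have hint : ∀ {v : Sp N → ℂ}, MemLp v 2 (wMeasure μ) → Integrable fun x => ψ x • v x :=
    fun hv => (locallyIntegrable_of_memLp_wMeasure h1 hv).integrable_smul_left_of_hasCompactSupport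
      hψ hs
  set K := tsupport ψ
  have hK : IsCompact K := hs
  obtain ⟨C, hC, hle⟩ := exists_restrict_le_smul_wMeasure h1 hK
  obtain ⟨B, hB⟩ := hs.exists_bound_of_continuous hψ
  have hset : ∀ v : Sp N → ℂ, ∫ x in K, ψ x • v x = ∫ x, ψ x • v x := fun v =>
    setIntegral_eq_integral_of_forall_compl_eq_zero fun x hx => by
      rw [image_eq_zero_of_notMem_tsupport hx, zero_smul]
  simp only [← hset]
  refine tendsto_integral_of_L1' _ (hint hf).integrableOn.1
    (Eventually.of_forall fun n => (hint (hh n)).integrableOn) ?_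
  have hbound : ∀ n, eLpNorm ((fun x => ψ x • h n x) - fun x => ψ x • f x) 1 (volume.restrict K) ≤
      ENNReal.ofReal B * (C ^ (1 / (2 : ℝ≥0∞).toReal) *
        eLpNorm (fun x => h n x - f x) 2 (wMeasure μ) *
        (volume.restrict K) Set.univ ^ (1 / (1 : ℝ≥0∞).toReal - 1 / (2 : ℝ≥0∞).toReal)) := by
    intro n
    have hd : MemLp (fun x => h n x - f x) 2 (wMeasure μ) := (hh n).sub hf
    have hd' : MemLp (fun x => h n x - f x) 2 (volume.restrict K) :=
      (hd.smul_measure hC).mono_measure hle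
    calc _ ≤ ENNReal.ofReal B * eLpNorm (fun x => h n x - f x) 1 (volume.restrict K) := by
          refine eLpNorm_le_mul_eLpNorm_of_ae_le_mul (Eventually.of_forall fun x => ?_) 1
          simp only [Pi.sub_apply, ← smul_sub, norm_smul]
          gcongr
          exact hB x
      _ ≤ ENNReal.ofReal B * (eLpNorm (fun x => h n x - f x) 2 (volume.restrict K) *
          (volume.restrict K) Set.univ ^ (1 / (1 : ℝ≥0∞).toReal - 1 / (2 : ℝ≥0∞).toReal)) := by
          gcongr
          exact eLpNorm_le_eLpNorm_mul_rpow_measure_univ (by norm_num) hd'.1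
      _ ≤ _ := by
          gcongr
          refine (eLpNorm_mono_measure _ hle).trans_eq ?_
          rw [eLpNorm_smul_measure_of_ne_top (by simp), smul_eq_mul, ENNReal.toReal_div,
            ENNReal.toReal_one]
  refine tendsto_of_tendsto_of_tendsto_of_le_of_le tendsto_const_nhds ?_ (fun _ => zero_le) hbound
  have hfin : (volume.restrict K) Set.univ ^
      (1 / (1 : ℝ≥0∞).toReal - 1 / (2 : ℝ≥0∞).toReal) ≠ ⊤ := by
    refine ENNReal.rpow_ne_top_of_nonneg (by norm_num) ?_
    simpa using hK.measure_lt_top.ne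
  have hCfin : C ^ (1 / (2 : ℝ≥0∞).toReal) ≠ ⊤ := ENNReal.rpow_ne_top_of_nonneg (by simp) hC
  have := ENNReal.Tendsto.const_mul (a := ENNReal.ofReal B) (ENNReal.Tendsto.mul_const
    (ENNReal.Tendsto.const_mul hlim (Or.inr hCfin)) (Or.inr hfin)) (Or.inr ENNReal.ofReal_ne_top)
  simpa using this

theorem hasWeakPartial_of_tendsto (h1 : HypH1 μ) (hμ : IsProbDensity μ) {u : ℕ → Sp N → ℂ}
    {f G : Sp N → ℂ} {i : Fin N} (hu : ∀ n, IsTest (u n)) (hf : MemLp f 2 (wMeasure μ))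
    (hG : MemLp G 2 (wMeasure μ))
    (hlim : Tendsto (fun n => eLpNorm (fun x => u n x - f x) 2 (wMeasure μ)) atTop (𝓝 0))
    (hlimG : Tendsto (fun n => eLpNorm (fun x => partialD i (u n) x - G x) 2 (wMeasure μ))
      atTop (𝓝 0)) : HasWeakPartial i f G := by
  refine ⟨locallyIntegrable_of_memLp_wMeasure h1 hf, locallyIntegrable_of_memLp_wMeasure h1 hG,
    fun φ hφ => ?_⟩
  have l1 := tendsto_integral_smul_of_eLpNorm h1 (fun n => (hu n).memLp_wMeasure hμ) hf hlim
    (hφ.partialD i).continuous (hφ.partialD i).2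
  have l2 := tendsto_integral_smul_of_eLpNorm h1
    (fun n => ((hu n).partialD i).memLp_wMeasure hμ) hG hlimG hφ.continuous hφ.2
  refine tendsto_nhds_unique l1 (l2.neg.congr fun n => ?_)
  rw [integral_partialD_smul hφ (hu n).1]

theorem rellich_of_closure (hN : 5 ≤ N) (hμ : IsProbDensity μ) (h2 : HypH2 μ) {C₁ : ℝ}
    (hC₁ : 0 < C₁) (hH : WeightedHardy μ C₁) (h1 : HypH1 μ) {f g : Sp N → ℂ}
    (hfg : ClosureL μ f g) :
    Integrable (fun x => ‖f x‖ ^ 2 / ‖x‖ ^ 4) (wMeasure μ) ∧ RellichEps μ C₁ f g ∧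
      ∃ G : Fin N → Sp N → ℂ,
        (∀ i, HasWeakPartial i f (G i) ∧ MemLp (G i) 2 (wMeasure μ)) ∧
        RellichSharp μ C₁ f g G := by
  obtain ⟨hf, hg, u, hu, hlu, hlL⟩ := hfg
  have hC := hardyC_ge hN
  have hc : 0 < hardyC N - 1 := by linarith
  have mu := fun n => (hu n).memLp_wMeasure hμ
  have mL := fun n => memLp_kolmogorov hμ h2 (hu n)
  have mD := fun i n => ((hu n).partialD i).memLp_wMeasure hμ
  have tU : Tendsto (fun n => (mu n).toLp (u n)) atTop (𝓝 (hf.toLp f)) :=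
    (Lp.tendsto_Lp_iff_tendsto_eLpNorm'' _ mu _ hf).2 hlu
  have tL : Tendsto (fun n => (mL n).toLp (kolmogorov μ (u n))) atTop (𝓝 (hg.toLp g)) :=
    (Lp.tendsto_Lp_iff_tendsto_eLpNorm'' _ mL _ hg).2 hlL
  -- By `integral_grad_sq_le` for `u m - u n`, the squared gradient distance is at most the product
  -- of two quantities below `ε`.
  have cauchy : ∀ i, CauchySeq fun n => (mD i n).toLp (partialD i (u n)) := fun i => by
    rw [Metric.cauchySeq_iff]
    intro ε hε
    obtain ⟨n₁, hn₁⟩ := Metric.cauchySeq_iff.1 tU.cauchySeq ε hε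
    obtain ⟨n₂, hn₂⟩ := Metric.cauchySeq_iff.1 tL.cauchySeq ε hε
    refine ⟨max n₁ n₂, fun m hm n hn => ?_⟩
    have a1 := hn₁ m (le_of_max_le_left hm) n (le_of_max_le_left hn)
    have a2 := hn₂ m (le_of_max_le_right hm) n (le_of_max_le_right hn)
    rw [dist_eq_norm, ← MemLp.toLp_sub] at a1 a2 ⊢
    have hd := (hu m).sub (hu n)
    have key := integral_grad_sq_le hμ h2 hd
    simp only [kolmogorov_sub (hu m) (hu n)] at key
    have k1 := norm_toLp_sq ((mu m).sub (mu n))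
    have k2 := norm_toLp_sq ((mL m).sub (mL n))
    have k3 := norm_toLp_sq ((mD i m).sub (mD i n))
    simp only [Pi.sub_apply] at k1 k2 k3
    rw [← k1, ← k2, Real.sqrt_sq (norm_nonneg _), Real.sqrt_sq (norm_nonneg _)] at key
    have k4 : ∫ x, ‖partialD i (u m) x - partialD i (u n) x‖ ^ 2 ∂(wMeasure μ) ≤
        ∫ x, ∑ j, ‖partialD j (fun y => u m y - u n y) x‖ ^ 2 ∂(wMeasure μ) := by
      refine integral_mono ?_ (integrable_sum_partialD_sq hμ hd) fun x => ?_
      · exact ((mD i m).sub (mD i n)).integrable_norm_pow (by norm_num)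
      · simp only [partialD_sub (hu m).differentiable (hu n).differentiable]
        exact Finset.single_le_sum
          (f := fun j => ‖partialD j (u m) x - partialD j (u n) x‖ ^ 2)
          (fun j _ => by positivity) (Finset.mem_univ i)
    rw [← k3] at k4
    refine lt_of_pow_lt_pow_left₀ 2 hε.le ((k4.trans key).trans_lt ?_)
    rw [sq]
    exact mul_lt_mul'' a1 a2 (norm_nonneg _) (norm_nonneg _)
  choose Γ hΓ using fun i => cauchySeq_tendsto_of_complete (cauchy i)
  let G : Fin N → Sp N → ℂ := fun i => Γ i
  have mG : ∀ i, MemLp (G i) 2 (wMeasure μ) := fun i => Lp.memLp (Γ i)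
  have tG : ∀ i, Tendsto (fun n => (mD i n).toLp (partialD i (u n))) atTop
      (𝓝 ((mG i).toLp (G i))) := fun i => by
    rw [Lp.toLp_coeFn]
    exact hΓ i
  have lU : Tendsto (fun n => ∫ x, ‖u n x‖ ^ 2 ∂(wMeasure μ)) atTop
      (𝓝 (∫ x, ‖f x‖ ^ 2 ∂(wMeasure μ))) := by
    simpa only [norm_toLp_sq] using tU.norm.pow 2
  have lL : Tendsto (fun n => ∫ x, ‖kolmogorov μ (u n) x‖ ^ 2 ∂(wMeasure μ)) atTop
      (𝓝 (∫ x, ‖g x‖ ^ 2 ∂(wMeasure μ))) := by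
    simpa only [norm_toLp_sq] using tL.norm.pow 2
  have lD : Tendsto (fun n => ∫ x, ∑ i, ‖partialD i (u n) x‖ ^ 2 ∂(wMeasure μ)) atTop
      (𝓝 (∫ x, ∑ i, ‖G i x‖ ^ 2 ∂(wMeasure μ))) := by
    have e1 : ∀ n, ∫ x, ∑ i, ‖partialD i (u n) x‖ ^ 2 ∂(wMeasure μ) =
        ∑ i, ∫ x, ‖partialD i (u n) x‖ ^ 2 ∂(wMeasure μ) := fun n =>
      integral_finsetSum _ fun i _ => (mD i n).integrable_norm_pow (by norm_num)
    have e2 : ∫ x, ∑ i, ‖G i x‖ ^ 2 ∂(wMeasure μ) = ∑ i, ∫ x, ‖G i x‖ ^ 2 ∂(wMeasure μ) :=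
      integral_finsetSum _ fun i _ => (mG i).integrable_norm_pow (by norm_num)
    simp only [e1, e2]
    refine tendsto_finsetSum _ fun i _ => ?_
    simpa only [norm_toLp_sq] using (tG i).norm.pow 2
  -- The singular integral is only lower semicontinuous along the approximation, so Fatou is applied
  -- on an almost everywhere convergent subsequence; the other integrals converge.
  obtain ⟨ns, hns, hae⟩ := (tendstoInMeasure_of_tendsto_eLpNorm (by norm_num)
    (fun n => (mu n).1) hf.1 hlu).exists_seq_tendsto_ae
  have ht := hns.tendsto_atTop
  have test := fun n => rellich_of_test hN hμ h2 hC₁ hH (hu n)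
  have fatou : ∀ {κ C : ℝ} {c : ℕ → ℝ}, 0 < κ → Tendsto c atTop (𝓝 C) →
      (∀ n, κ * (∫ x, ‖u n x‖ ^ 2 / ‖x‖ ^ 4 ∂(wMeasure μ)) ≤ c n) →
      Integrable (fun x => ‖f x‖ ^ 2 / ‖x‖ ^ 4) (wMeasure μ) ∧
        κ * (∫ x, ‖f x‖ ^ 2 / ‖x‖ ^ 4 ∂(wMeasure μ)) ≤ C := by
    intro κ C c hκ hcC h
    have := integrable_and_integral_le_of_tendsto (ν := wMeasure μ)
      (f := fun n x => ‖u (ns n) x‖ ^ 2 / ‖x‖ ^ 4) (g := fun x => ‖f x‖ ^ 2 / ‖x‖ ^ 4)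
      (c := fun n => c (ns n) / κ) (C := C / κ) (fun n => (test (ns n)).1)
      (fun n => Eventually.of_forall fun x => by positivity)
      (by
        filter_upwards [hae] with x hx
        exact (hx.norm.pow 2).div_const _)
      (fun n => by rw [le_div_iff₀ hκ, mul_comm]; exact h (ns n))
      ((hcC.comp ht).div_const κ)
    refine ⟨this.1, ?_⟩
    rw [mul_comm, ← le_div_iff₀ hκ]
    exact this.2
  obtain ⟨f1, f2⟩ := fatou (by positivity : 0 < (hardyC N - 1) ^ 2)
    ((lL.add (lD.const_mul _)).add (lU.const_mul _)) fun n => (test n).2.2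
  refine ⟨f1, fun ε hε => ?_, G, fun i => ⟨?_, mG i⟩, f2⟩
  · rcases le_or_gt ((hardyC N - 1) ^ 2 - ε) 0 with hneg | hκ
    · have h3 : 0 ≤ ∫ x, ‖f x‖ ^ 2 / ‖x‖ ^ 4 ∂(wMeasure μ) :=
        integral_nonneg fun x => by positivity
      have h4 : 0 ≤ ∫ x, ‖g x‖ ^ 2 ∂(wMeasure μ) := integral_nonneg fun x => by positivity
      have h5 : 0 ≤ ∫ x, ‖f x‖ ^ 2 ∂(wMeasure μ) := integral_nonneg fun x => by positivity
      exact (mul_nonpos_of_nonpos_of_nonneg hneg h3).trans (by positivity)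
    · exact (fatou hκ (lL.add (lU.const_mul _)) fun n => (test n).2.1 ε hε).2
  · exact hasWeakPartial_of_tendsto h1 hμ hu hf (mG i) hlu
      ((Lp.tendsto_Lp_iff_tendsto_eLpNorm'' _ (mD i) _ (mG i)).1 (tG i))

end Closure

end WeightedRellich

end

theorem mainTheorem1 (N : ℕ) (hN : 5 ≤ N) (μ : WeightedRellich.Sp N → ℝ)
    (hμ : WeightedRellich.IsProbDensity μ) (h2 : WeightedRellich.HypH2 μ) :
    (∃ C₁ : ℝ, 0 < C₁ ∧ WeightedRellich.WeightedHardy μ C₁) ∧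
    ∀ C₁ : ℝ, 0 < C₁ → WeightedRellich.WeightedHardy μ C₁ →
      (∀ u : WeightedRellich.Sp N → ℂ, WeightedRellich.IsTest u →
        Integrable (fun x => ‖u x‖ ^ 2 / ‖x‖ ^ 4) (WeightedRellich.wMeasure μ) ∧
        MemLp (WeightedRellich.kolmogorov μ u) 2 (WeightedRellich.wMeasure μ) ∧
        WeightedRellich.RellichEps μ C₁ u (WeightedRellich.kolmogorov μ u) ∧
        WeightedRellich.RellichSharp μ C₁ u (WeightedRellich.kolmogorov μ u)
          (fun i => WeightedRellich.partialD i u)) ∧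
      (WeightedRellich.HypH1 μ →
        ∀ f g : WeightedRellich.Sp N → ℂ, WeightedRellich.ClosureL μ f g →
          Integrable (fun x => ‖f x‖ ^ 2 / ‖x‖ ^ 4) (WeightedRellich.wMeasure μ) ∧
          WeightedRellich.RellichEps μ C₁ f g ∧
          ∃ G : Fin N → WeightedRellich.Sp N → ℂ,
            (∀ i, WeightedRellich.HasWeakPartial i f (G i) ∧
              MemLp (G i) 2 (WeightedRellich.wMeasure μ)) ∧
            WeightedRellich.RellichSharp μ C₁ f g G) := by
  refine ⟨WeightedRellich.exists_weightedHardy hN hμ h2, fun C₁ hC₁ hH => ⟨fun u hu => ?_,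
    fun h1 f g hfg => WeightedRellich.rellich_of_closure hN hμ h2 hC₁ hH h1 hfg⟩⟩
  obtain ⟨hi, he, hs⟩ := WeightedRellich.rellich_of_test hN hμ h2 hC₁ hH hu
  exact ⟨hi, WeightedRellich.memLp_kolmogorov hμ h2 hu, he, hs⟩
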